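/- Let $H_1\subset GL_2(\mathbb C)$ be the primitive complex reflection group of order $96$ (number $8$ in the Shephard–Todd list), generated by $T=\frac{1+i}{2}\begin{pmatrix}1&1\\1&-1\end{pmatrix}$ and $D=\mathrm{diag}(1,i)$. For a subgroup $K\le H_1$ consider the transitive permutation representation of $H_1$ on the cosets of $K$. Put $$K_1=1,\quad K_3=\langle D^2\rangle,\quad K_4=\langle (TD)^2\rangle,\quad K_8=\langle -D\rangle,\quad K_9=\langle D\rangle$$ (of orders $1,2,3,4,4$), and let $\theta_i$ $(i=1,3,4,8,9)$ be the permutation character of $H_1$ on the cosets of $K_i$. For a finite $H_1$-set $\Omega$ and $k\ge 1$ let $\mathfrak A_\Omega^{(k)}$ be the centralizer ring of the $k$-th tensor power of the permutation representation, that is, the algebra of all linear endomorphisms of $(\mathbb C\Omega)^{\otimes k}$ commuting with the diagonal action of $H_1$; it is written $\mathfrak A_{\theta_i}^{(k)}$ when $\Omega$ has permutation character $\theta_i$. Let $nM_r$ be the direct sum of $n$ copies of the algebra $M_r$ of complex $r\times r$ matrices ($M_0=0$). **Theorem.** The five permutation representations on the cosets of the $K_i$ are faithful, and every faithful transitive permutation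 representation of $H_1$ is equivalent to exactly one of them. The group $H_1$ has exactly $16$ irreducible complex characters, and they can be numbered $\chi_1,\dots,\chi_{16}$, with $\chi_1$ the identity character, such that for every faithful transitive $H_1$-set with permutation character $\theta_i$ and every $k\ge1$ the following holds, where $\vec d^{(k)}=(d^{(k)}_1,\dots,d^{(k)}_{16})$ denotes the vector of multiplicities in $\theta_i^k=\sum_j d_j^{(k)}\chi_j$ (the numbering is the same for all $i$ and $k$). All numbers $a_k,b_k,\dots,p_k$ below are non-negative integers. 1. For $\theta_1$: $\vec d^{(k)}=(a_k,a_k,a_k,a_k,e_k,e_k,e_k,e_k,e_k,e_k,l_k,l_k,l_k,l_k,p_k,p_k)$ and $$\mathfrak A_{\theta_1}^{(k)}\cong 4M_{a_k}\oplus 6M_{e_k}\oplus 4M_{l_k}\oplus 2M_{p_k},$$ with $a_k=96^{k-1}$, $e_k=\frac{96^k}{48}$, $l_k=\frac{96^k}{32}$, $p_k=\frac{96^k}{24}$. 2. For $\theta_3$: $\vec d^{(k)}=(a_k,a_k,c_k,c_k,e_k,f_k,g_k,g_k,g_k,g_k,l_k,l_k,n_k,n_k,p_k,p_k)$ and $$\mathfrak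 A_{\theta_3}^{(k)}\cong 2M_{a_k}\oplus 2M_{c_k}\oplus M_{e_k}\oplus M_{f_k}\oplus 4M_{g_k}\oplus 2M_{l_k}\oplus 2M_{n_k}\oplus 2M_{p_k},$$ with $a_k=\frac{48^{k-1}}2+\frac{8^{k-1}}2$, $c_k=\frac{48^{k-1}}2-\frac{8^{k-1}}2$, $e_k=48^{k-1}+8^{k-1}$, $f_k=48^{k-1}-8^{k-1}$, $g_k=48^{k-1}$, $l_k=\frac{48^k}{32}-\frac{8^{k-1}}2$, $n_k=\frac{48^k}{32}+\frac{8^{k-1}}2$, $p_k=\frac{48^k}{24}$. 3. For $\theta_4$: $\vec d^{(k)}=(a_k,a_k,a_k,a_k,e_k,e_k,e_k,e_k,e_k,e_k,l_k,l_k,l_k,l_k,p_k,p_k)$ and $$\mathfrak A_{\theta_4}^{(k)}\cong 4M_{a_k}\oplus 6M_{e_k}\oplus 4M_{l_k}\oplus 2M_{p_k},$$ with $a_k=\frac{32^{k-1}}3+\frac{8^k}{12}$, $e_k=\frac{32^k}{48}-\frac{8^k}{12}$, $l_k=32^{k-1}$, $p_k=\frac{32^k}{24}+\frac{8^k}{12}$.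 4. For $\theta_8$ and for $\theta_9$: $$\mathfrak A^{(k)}\cong M_{a_k}\oplus 3M_{b_k}\oplus M_{e_k}\oplus 3M_{f_k}\oplus 2M_{e_k}\oplus M_{l_k}\oplus 3M_{m_k}\oplus 2M_{p_k},$$ with $a_k=\frac{24^{k-1}}4+3\cdot4^{k-2}$, $b_k=\frac{24^{k-1}}4-4^{k-2}$, $e_k=\frac{24^{k-1}}2+\frac{4^{k-1}}2$, $f_k=\frac{24^{k-1}}2-\frac{4^{k-1}}2$, $l_k=\frac{24^k}{32}-3\cdot4^{k-2}$, $m_k=\frac{24^k}{32}+4^{k-2}$, $p_k=24^{k-1}$; here $\vec d^{(k)}=(a_k,b_k,b_k,b_k,e_k,f_k,e_k,e_k,f_k,f_k,l_k,m_k,m_k,m_k,p_k,p_k)$ for $\theta_8$ and $\vec d^{(k)}=(a_k,b_k,b_k,b_k,e_k,f_k,f_k,f_k,e_k,e_k,l_k,m_k,m_k,m_k,p_k,p_k)$ for $\theta_9$. -/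

import Mathlib

noncomputable section

namespace CentralizerH1

/-- The generator `T = (1 + i)/2 * [[1, 1], [1, -1]]`. -/
def matT : Matrix.GeneralLinearGroup (Fin 2) ℂ :=
  Matrix.GeneralLinearGroup.mkOfDetNeZero
    (((1 + Complex.I) / 2) • !![1, 1; 1, -1]) (by
      have h : (1 + Complex.I) ≠ 0 := by
        intro h
        have := congrArg Complex.re h
        simp at this
      rw [Matrix.det_smul, Matrix.det_fin_two_of]
      refine mul_ne_zero (pow_ne_zero _ (div_ne_zero h two_ne_zero)) ?_
      norm_num)

/-- The generator `D = diag(1, i)`, a complex reflection of order 4. -/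
def matD : Matrix.GeneralLinearGroup (Fin 2) ℂ :=
  Matrix.GeneralLinearGroup.mkOfDetNeZero !![1, 0; 0, Complex.I] (by
    rw [Matrix.det_fin_two_of]
    simp)

/-- The primitive complex reflection group `H₁` of order 96
(number 8 in the Shephard-Todd list), generated by `T` and `D`. -/
def H1 : Subgroup (Matrix.GeneralLinearGroup (Fin 2) ℂ) :=
  Subgroup.closure {matT, matD}

/-- `T` as an element of `H₁`. -/
def t : H1 := ⟨matT, Subgroup.subset_closure (by simp)⟩

/-- `D` as an element of `H₁`. -/
def d : H1 := ⟨matD, Subgroup.subset_closure (by simp)⟩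

/-- Labels of the five faithful transitive permutation representations. -/
inductive Label
  | one | three | four | eight | nine

/-- The five point stabilizers, of orders 1, 2, 3, 4, 4. Here `(td)³ = -1`, so that the fourth
one is generated by `-D`. -/
def stab : Label → Subgroup H1
  | .one => ⊥
  | .three => Subgroup.zpowers (d ^ 2)
  | .four => Subgroup.zpowers ((t * d) ^ 2)
  | .eight => Subgroup.zpowers ((t * d) ^ 3 * d)
  | .nine => Subgroup.zpowers d

/-- The permutation character: the number of fixed points. -/
def permChar (G : Type*) [Group G] (Ω : Type*) [MulAction G Ω] (g : G) : ℂ :=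
  (Nat.card (MulAction.fixedBy Ω g) : ℂ)

/-- The permutation character `θᵢ` of `H₁` acting on the cosets of the `i`-th stabilizer. -/
def θ (i : Label) : H1 → ℂ := permChar H1 (H1 ⧸ stab i)

/-- Equivalence of permutation representations: an equivariant bijection. -/
def PermEquiv (G : Type*) [Group G] (Ω Ω' : Type*) [MulAction G Ω] [MulAction G Ω'] : Prop :=
  ∃ f : Ω ≃ Ω', ∀ (g : G) (x : Ω), f (g • x) = g • f x

/-- The `k`-th tensor power `g ↦ ρ(g) ⊗ ⋯ ⊗ ρ(g)` of a representation. -/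
def tensorPower {G V : Type*} [Group G] [AddCommGroup V] [Module ℂ V]
    (ρ : Representation ℂ G V) (k : ℕ) :
    Representation ℂ G (PiTensorProduct ℂ (fun _ : Fin k => V)) :=
  PiTensorProduct.mapMonoidHom.comp (MonoidHom.pi fun _ : Fin k => ρ)

/-- The centralizer ring of the `k`-th tensor power of the permutation representation of `G` on
`Ω`: all linear endomorphisms of `(ℂΩ)^{⊗k}` that commute with every group element. -/
def centralizerRing (G : Type*) [Group G] (Ω : Type*) [MulAction G Ω] (k : ℕ) :
    Subalgebra ℂ
      (Module.End ℂ (PiTensorProduct ℂ (fun _ : Fin k => MonoidAlgebra ℂ Ω))) :=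
  Subalgebra.centralizer ℂ
    (Set.range (tensorPower (Representation.ofMulAction ℂ G Ω) k))

/-- Irreducible complex characters of `G`. -/
def IsIrreducibleCharacter {G : Type*} [Group G] (f : G → ℂ) : Prop :=
  ∃ (n : ℕ) (ρ : Representation ℂ G (Fin n → ℂ)), ρ.IsIrreducible ∧ ρ.character = f

/-- `nM n r` is the direct sum of `n` copies of the full matrix algebra of degree `r` over `ℂ`
(the zero algebra when `r = 0`). -/
abbrev nM (n r : ℕ) : Type := Fin n → Matrix (Fin r) (Fin r) ℂ

/-- `v` lists the multiplicities of `χ 0, …, χ 15` in `f`. -/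
def HasMultiplicities {G : Type*} (χ : Fin 16 → G → ℂ) (f : G → ℂ) (v : Fin 16 → ℕ) : Prop :=
  ∀ g, f g = ∑ j, (v j : ℂ) * χ j g

end CentralizerH1

end

/-! Two facts carry the multiplicities and the centralizers. On the nontrivial elements, each
permutation character θ takes at most one nonzero value c (`G0.sum_mult_char`). Hence θ^(k+1) - c^k
θ vanishes off the identity, so it is a multiple of the regular character, and every multiplicity in
a power of θ follows in closed form from the one in θ and the degree (`sum_powMult_chi`). Moreover,
if matrix representations R_j of degrees n_j satisfy Σ n_j tr R_j = regular character, then ℂ[G] is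
the product of the algebras M_{n_j} (`RegularIdentity.bijective`). This one identity replaces the
orthogonality relations: it gives irreducibility, linear independence and completeness of the
characters, and it shows that a representation with multiplicities v_j has centralizer ∏ M_{v_j}
(`nonempty_centralizer_equiv`). The stabilizer of a point in a faithful transitive set cannot
contain the central element -1. Up to conjugacy only the five cyclic groups have this property
(`G0.exists_conj`). Conversely, the values of θ show that the five actions are faithful and pairwise
inequivalent. All finite checks take place in `G0`, the image of H₁ in GL₂(𝔽₅) under i ↦ 2. The
fourth roots of unity map bijectively to the units of 𝔽₅, so the complex matrices can be recovered.
-/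

noncomputable section

set_option linter.unusedSectionVars false

namespace CentralizerH1

/-! ### Centralizers of products of matrix algebras. -/

section MatrixProduct

variable {ι : Type*} [Fintype ι] [DecidableEq ι] {m : ι → Type*} [∀ j, Fintype (m j)]
  [∀ j, DecidableEq (m j)]

/-- The matrix unit `e_{ab}` in the `j`-th factor of a product of matrix algebras. -/
def matUnit (j : ι) (a b : m j) : ∀ j, Matrix (m j) (m j) ℂ :=
  Pi.single j (Matrix.single a b 1)

lemma matUnit_mul_same (j : ι) (a b c : m j) :
    matUnit j a b * matUnit j b c = matUnit j a c := by
  simp [matUnit, ← Pi.single_mul]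

lemma matUnit_mul_of_ne (j : ι) (a : m j) {b c : m j} (d : m j) (h : b ≠ c) :
    matUnit j a b * matUnit j c d = 0 := by
  rw [matUnit, matUnit, ← Pi.single_mul, Matrix.single_mul_single_of_ne _ _ _ _ h, Pi.single_zero]

lemma matUnit_mul_of_ne_index {i j : ι} (h : i ≠ j) (a b : m i) (c d : m j) :
    matUnit i a b * matUnit j c d = 0 := by
  funext l
  by_cases hl : l = i
  · subst hl
    simp [matUnit, Pi.single_eq_of_ne h]
  · simp [matUnit, Pi.single_eq_of_ne hl]

lemma sum_matUnit : ∑ j, ∑ a : m j, matUnit j a a = 1 := by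
  have h (j : ι) : ∑ a : m j, matUnit j a a = Pi.single j (1 : Matrix (m j) (m j) ℂ) := by
    simp_rw [matUnit]
    rw [← Matrix.sum_single_one]
    exact (map_sum (AddMonoidHom.single (fun j => Matrix (m j) (m j) ℂ) j) _ _).symm
  simp_rw [h]
  exact Finset.univ_sum_single (1 : ∀ j, Matrix (m j) (m j) ℂ)

variable {V : Type*} [AddCommGroup V] [Module ℂ V]
  (Ψ : (∀ j, Matrix (m j) (m j) ℂ) →ₐ[ℂ] Module.End ℂ V) (z : ∀ j, m j)

/-- The multiplicity space of the `j`-th factor. -/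
def multSpace (j : ι) : Submodule ℂ V := LinearMap.range (Ψ (matUnit j (z j) (z j)))

lemma mul_apply_eq (x y : ∀ j, Matrix (m j) (m j) ℂ) (v : V) : Ψ x (Ψ y v) = Ψ (x * y) v := by
  rw [map_mul]; rfl

lemma apply_of_mem_multSpace {j : ι} {v : V} (hv : v ∈ multSpace Ψ z j) :
    Ψ (matUnit j (z j) (z j)) v = v := by
  obtain ⟨w, rfl⟩ := hv
  rw [mul_apply_eq, matUnit_mul_same]

lemma mapsTo_multSpace (A : Subalgebra.centralizer ℂ (Set.range Ψ)) (j : ι) :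
    ∀ v ∈ multSpace Ψ z j, (A : Module.End ℂ V) v ∈ multSpace Ψ z j := by
  rintro _ ⟨w, rfl⟩
  refine ⟨(A : Module.End ℂ V) w, ?_⟩
  exact LinearMap.congr_fun (Subalgebra.mem_centralizer_iff ℂ |>.1 A.2 _ ⟨_, rfl⟩) w

/-- Restriction of the centralizer to the multiplicity spaces. -/
def centralizerRestrict :
    Subalgebra.centralizer ℂ (Set.range Ψ) →ₐ[ℂ] ∀ j, Module.End ℂ (multSpace Ψ z j) where
  toFun A j := (A : Module.End ℂ V).restrict (mapsTo_multSpace Ψ z A j)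
  map_one' := rfl
  map_mul' _ _ := rfl
  map_zero' := rfl
  map_add' _ _ := rfl
  commutes' _ := rfl

/-- The identity is the sum of the e_aa = e_a0 e_0a, so V is spanned by translates of the
multiplicity spaces; a commuting endomorphism is thus determined on them. -/
lemma eq_sum_apply (v : V) :
    v = ∑ j, ∑ a : m j, Ψ (matUnit j a (z j)) (Ψ (matUnit j (z j) a) v) := by
  simp_rw [mul_apply_eq, matUnit_mul_same]
  conv_lhs => rw [← Module.End.one_apply (R := ℂ) v, ← map_one Ψ, ← sum_matUnit]
  simp [map_sum, LinearMap.sum_apply]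

lemma centralizerRestrict_injective : Function.Injective (centralizerRestrict Ψ z) := by
  rw [injective_iff_map_eq_zero]
  intro A hA
  ext v
  have hc (x) (w : V) : (A : Module.End ℂ V) (Ψ x w) = Ψ x ((A : Module.End ℂ V) w) :=
    (LinearMap.congr_fun (Subalgebra.mem_centralizer_iff ℂ |>.1 A.2 _ ⟨x, rfl⟩) w).symm
  have h0 (j : ι) (w : V) (hw : w ∈ multSpace Ψ z j) : (A : Module.End ℂ V) w = 0 :=
    congrArg Subtype.val (LinearMap.congr_fun (congrFun hA j) ⟨w, hw⟩)
  rw [eq_sum_apply Ψ z v, map_sum]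
  refine Finset.sum_eq_zero fun j _ => ?_
  rw [map_sum]
  refine Finset.sum_eq_zero fun a _ => ?_
  rw [hc, h0 j _ ⟨Ψ (matUnit j (z j) a) v, by rw [mul_apply_eq, matUnit_mul_same]⟩, map_zero]

lemma mem_multSpace (j : ι) (a : m j) (v : V) : Ψ (matUnit j (z j) a) v ∈ multSpace Ψ z j :=
  ⟨Ψ (matUnit j (z j) a) v, by rw [mul_apply_eq, matUnit_mul_same]⟩

/-- The action of `e_{0a}` as a map to the multiplicity space. -/
def toMultSpace (j : ι) (a : m j) : V →ₗ[ℂ] multSpace Ψ z j :=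
  (Ψ (matUnit j (z j) a)).codRestrict _ (mem_multSpace Ψ z j a)

/-- The extension to `V` of an endomorphism of a multiplicity space. -/
def extendEnd (j : ι) (B : Module.End ℂ (multSpace Ψ z j)) : Module.End ℂ V :=
  ∑ a : m j, Ψ (matUnit j a (z j)) ∘ₗ (multSpace Ψ z j).subtype ∘ₗ B ∘ₗ toMultSpace Ψ z j a

lemma extendEnd_apply (j : ι) (B : Module.End ℂ (multSpace Ψ z j)) (v : V) :
    extendEnd Ψ z j B v = ∑ a : m j, Ψ (matUnit j a (z j)) (B (toMultSpace Ψ z j a v)) := by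
  simp [extendEnd, LinearMap.sum_apply]

lemma toMultSpace_apply_same (j : ι) (a b c : m j) (v : V) :
    toMultSpace Ψ z j a (Ψ (matUnit j b c) v) =
      if a = b then toMultSpace Ψ z j c v else 0 := by
  ext
  split_ifs with h
  · subst h
    simp [toMultSpace, mul_apply_eq, matUnit_mul_same]
  · simp [toMultSpace, mul_apply_eq, matUnit_mul_of_ne _ _ _ h]

lemma toMultSpace_apply_ne {i j : ι} (h : i ≠ j) (a : m i) (b c : m j) (v : V) :
    toMultSpace Ψ z i a (Ψ (matUnit j b c) v) = 0 := by
  ext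
  simp [toMultSpace, mul_apply_eq, matUnit_mul_of_ne_index h]

lemma extendEnd_comm_matUnit (i : ι) (B : Module.End ℂ (multSpace Ψ z i)) (j : ι) (b c : m j) :
    Ψ (matUnit j b c) * extendEnd Ψ z i B = extendEnd Ψ z i B * Ψ (matUnit j b c) := by
  ext v
  rw [Module.End.mul_apply, Module.End.mul_apply, extendEnd_apply, extendEnd_apply, map_sum]
  by_cases h : i = j
  · subst h
    simp_rw [toMultSpace_apply_same, mul_apply_eq]
    rw [Finset.sum_eq_single c, Finset.sum_eq_single b]
    · simp [matUnit_mul_same]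
    · intro a _ ha; simp [ha]
    · simp
    · intro a _ ha; simp [matUnit_mul_of_ne _ _ _ ha.symm]
    · simp
  · simp_rw [toMultSpace_apply_ne Ψ z h, mul_apply_eq, matUnit_mul_of_ne_index (Ne.symm h)]
    simp

lemma matrixPi_ext {M : Type*} [AddCommGroup M] [Module ℂ M]
    {f g : (∀ j, Matrix (m j) (m j) ℂ) →ₗ[ℂ] M}
    (h : ∀ j (a b : m j), f (matUnit j a b) = g (matUnit j a b)) : f = g := by
  refine LinearMap.pi_ext' fun j => ?_
  refine Matrix.ext_linearMap _ fun a b => ?_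
  ext
  exact h j a b

lemma extendEnd_mem (i : ι) (B : Module.End ℂ (multSpace Ψ z i)) :
    extendEnd Ψ z i B ∈ Subalgebra.centralizer ℂ (Set.range Ψ) := by
  rw [Subalgebra.mem_centralizer_iff]
  rintro _ ⟨x, rfl⟩
  have : (LinearMap.mulRight ℂ (extendEnd Ψ z i B)) ∘ₗ Ψ.toLinearMap =
      (LinearMap.mulLeft ℂ (extendEnd Ψ z i B)) ∘ₗ Ψ.toLinearMap :=
    matrixPi_ext fun j b c => extendEnd_comm_matUnit Ψ z i B j b c
  exact LinearMap.congr_fun this x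

lemma centralizerRestrict_surjective : Function.Surjective (centralizerRestrict Ψ z) := by
  intro B
  refine ⟨∑ i, ⟨extendEnd Ψ z i (B i), extendEnd_mem Ψ z i (B i)⟩, ?_⟩
  funext j
  refine LinearMap.ext fun w => Subtype.ext ?_
  change ((∑ i, (⟨extendEnd Ψ z i (B i), extendEnd_mem Ψ z i (B i)⟩ :
    Subalgebra.centralizer ℂ (Set.range Ψ)) :
      Subalgebra.centralizer ℂ (Set.range Ψ)) : Module.End ℂ V) w = B j w
  rw [AddSubmonoidClass.coe_finsetSum, LinearMap.sum_apply]
  have hw := apply_of_mem_multSpace Ψ z w.2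
  have hw' : toMultSpace Ψ z j (z j) w = w := Subtype.ext hw
  -- On a vector fixed by e_00 of the j-th factor, only the term with i = j and a = `z j` survives.
  rw [Finset.sum_eq_single j]
  · rw [← hw, extendEnd_apply]
    simp_rw [toMultSpace_apply_same]
    rw [Finset.sum_eq_single (z j)]
    · rw [if_pos rfl, hw']
      exact apply_of_mem_multSpace Ψ z (B j w).2
    · intro a _ ha; simp [ha]
    · simp
  · intro i _ hi
    rw [← hw]
    simp [extendEnd_apply, toMultSpace_apply_ne Ψ z hi]
  · simp

/-- By cyclicity of the trace, e_aa = e_a0 e_0a has the trace of e_0a e_a0 = e_00, a projection onto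
the multiplicity space. -/
lemma trace_apply_matUnit_same [FiniteDimensional ℂ V] (j : ι) (a : m j) :
    LinearMap.trace ℂ V (Ψ (matUnit j a a)) = Module.finrank ℂ (multSpace Ψ z j) := by
  rw [← matUnit_mul_same j a (z j) a, map_mul, LinearMap.trace_mul_comm, ← map_mul,
    matUnit_mul_same]
  refine LinearMap.IsProj.trace ⟨fun v => ⟨v, rfl⟩, fun v hv => ?_⟩
  exact apply_of_mem_multSpace Ψ z hv

lemma trace_apply_matUnit_of_ne (j : ι) {a b : m j} (h : a ≠ b) :
    LinearMap.trace ℂ V (Ψ (matUnit j a b)) = 0 := by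
  rw [← matUnit_mul_same j a b b, map_mul, LinearMap.trace_mul_comm, ← map_mul,
    matUnit_mul_of_ne _ _ _ h.symm, map_zero, map_zero]

/-- The trace of a representation of a product of matrix algebras. -/
lemma trace_apply [FiniteDimensional ℂ V] (x : ∀ j, Matrix (m j) (m j) ℂ) :
    LinearMap.trace ℂ V (Ψ x) =
      ∑ j, (Module.finrank ℂ (multSpace Ψ z j) : ℂ) * (x j).trace := by
  have : LinearMap.trace ℂ V ∘ₗ Ψ.toLinearMap =
      ∑ j, (Module.finrank ℂ (multSpace Ψ z j) : ℂ) •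
        (Matrix.traceLinearMap (m j) ℂ ℂ ∘ₗ LinearMap.proj j) := by
    refine matrixPi_ext fun i a b => ?_
    simp only [LinearMap.sum_apply, LinearMap.smul_apply, LinearMap.comp_apply, LinearMap.proj_apply,
      Matrix.traceLinearMap_apply, smul_eq_mul, AlgHom.toLinearMap_apply]
    rw [Finset.sum_eq_single i]
    · by_cases h : a = b
      · subst h
        rw [trace_apply_matUnit_same Ψ z]
        simp [matUnit]
      · rw [trace_apply_matUnit_of_ne Ψ i h]
        simp [matUnit, h]
    · intro j _ hj
      simp [matUnit, Pi.single_eq_of_ne hj]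
    · simp
  simpa using LinearMap.congr_fun this x

/-- The centralizer of a product of matrix algebras is a product of matrix algebras. -/
lemma nonempty_centralizer_equiv [FiniteDimensional ℂ V] :
    Nonempty (Subalgebra.centralizer ℂ (Set.range Ψ) ≃ₐ[ℂ]
      ∀ j, Matrix (Fin (Module.finrank ℂ (multSpace Ψ z j)))
        (Fin (Module.finrank ℂ (multSpace Ψ z j))) ℂ) :=
  ⟨(AlgEquiv.ofBijective _ ⟨centralizerRestrict_injective Ψ z,
    centralizerRestrict_surjective Ψ z⟩).trans
    (AlgEquiv.piCongrRight fun _ => LinearMap.toMatrixAlgEquiv (Module.finBasis ℂ _))⟩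

end MatrixProduct

/-! ### The group algebra as a product of matrix algebras, and its irreducible characters. -/

section RegularIdentity

variable {G : Type*} [Group G] [Fintype G] [DecidableEq G]
  {ι : Type*} [Fintype ι] [DecidableEq ι] {n : ι → ℕ}
  (R : ∀ j, G →* Matrix (Fin (n j)) (Fin (n j)) ℂ)

/-- The regular character is the sum of the characters of the `R j` weighted by their degrees. -/
def RegularIdentity : Prop :=
  ∀ g, ∑ j, (n j : ℂ) * (R j g).trace = if g = 1 then (Fintype.card G : ℂ) else 0

/-- The joint extension of the matrix representations to the group algebra. -/
def groupAlgebraHom : MonoidAlgebra ℂ G →ₐ[ℂ] ∀ j, Matrix (Fin (n j)) (Fin (n j)) ℂ :=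
  AlgHom.pi fun j => MonoidAlgebra.lift ℂ _ G (R j)

lemma groupAlgebraHom_single (g : G) (c : ℂ) :
    groupAlgebraHom R (MonoidAlgebra.single g c) = c • fun j => R j g := by
  funext j
  simp [groupAlgebraHom]

variable {R}

/-- Linear extension of the identity: the weighted trace recovers the coefficient at 1, and after
translation by g⁻¹ every coefficient. This is why no nonzero x dies in all the representations. -/
lemma RegularIdentity.sum_trace (h : RegularIdentity R) (x : MonoidAlgebra ℂ G) :
    ∑ j, (n j : ℂ) * (groupAlgebraHom R x j).trace = Fintype.card G * x.coeff 1 := by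
  induction x using MonoidAlgebra.induction_linear with
  | zero => simp
  | add x y hx hy => simp [mul_add, Finset.sum_add_distrib, hx, hy]
  | single g c =>
    have := congrArg (c * ·) (h g)
    simp only [Finset.mul_sum] at this
    rw [groupAlgebraHom_single]
    simp only [Pi.smul_apply, Matrix.trace_smul, smul_eq_mul, mul_left_comm _ c, this]
    by_cases hg : g = 1
    · simp [hg, mul_comm]
    · simp [hg]

lemma RegularIdentity.injective (h : RegularIdentity R) :
    Function.Injective (groupAlgebraHom R) := by
  rw [injective_iff_map_eq_zero]
  intro x hx
  ext g
  have := h.sum_trace (x * MonoidAlgebra.single g⁻¹ 1)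
  rw [map_mul, hx] at this
  have hc : (Fintype.card G : ℂ) ≠ 0 := by simp
  simpa [hc, MonoidAlgebra.coeff_mul_single_apply] using this

/-- At g = 1 the identity reads Σ n_j² = |G|, so the dimensions agree and injectivity suffices. -/
lemma RegularIdentity.bijective (h : RegularIdentity R) :
    Function.Bijective (groupAlgebraHom R) := by
  have hd : Module.finrank ℂ (MonoidAlgebra ℂ G) =
      Module.finrank ℂ (∀ j, Matrix (Fin (n j)) (Fin (n j)) ℂ) := by
    rw [(MonoidAlgebra.coeffLinearEquiv ℂ).finrank_eq, Module.finrank_finsupp_self,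
      Module.finrank_pi_fintype]
    have := h 1
    simp only [map_one, Matrix.trace_one, Fintype.card_fin, if_pos] at this
    simp only [Module.finrank_matrix, Fintype.card_fin, Module.finrank_self, mul_one]
    exact_mod_cast this.symm
  have : FiniteDimensional ℂ (MonoidAlgebra ℂ G) :=
    Module.Finite.equiv (MonoidAlgebra.coeffLinearEquiv ℂ).symm
  exact ⟨h.injective, (LinearMap.injective_iff_surjective_of_finrank_eq_finrank hd
    (f := (groupAlgebraHom R).toLinearMap)).1 h.injective⟩

/-- The group algebra is a product of matrix algebras. -/
def RegularIdentity.algEquiv (h : RegularIdentity R) :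
    MonoidAlgebra ℂ G ≃ₐ[ℂ] ∀ j, Matrix (Fin (n j)) (Fin (n j)) ℂ :=
  AlgEquiv.ofBijective _ h.bijective

lemma RegularIdentity.algEquiv_symm (h : RegularIdentity R) (g : G) :
    h.algEquiv.symm (fun j => R j g) = MonoidAlgebra.single g 1 := by
  rw [AlgEquiv.symm_apply_eq]
  exact (by rw [groupAlgebraHom_single, one_smul] : groupAlgebraHom R _ = _).symm

variable (R) in
/-- The characters of the `R j`. -/
def matChar (j : ι) (g : G) : ℂ := (R j g).trace

lemma centralizer_range_asAlgebraHom {V : Type*} [AddCommGroup V] [Module ℂ V]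
    (ρ : Representation ℂ G V) :
    Subalgebra.centralizer ℂ (Set.range ρ.asAlgebraHom) =
      Subalgebra.centralizer ℂ (Set.range ρ) := by
  refine le_antisymm (Subalgebra.centralizer_le ℂ _ _ ?_) fun A hA => ?_
  · rintro _ ⟨g, rfl⟩
    exact ⟨MonoidAlgebra.single g 1, by simp⟩
  · rw [Subalgebra.mem_centralizer_iff] at hA ⊢
    rintro _ ⟨x, rfl⟩
    induction x using MonoidAlgebra.induction_linear with
    | zero => simp
    | add x y hx hy => rw [map_add, add_mul, mul_add, hx, hy]
    | single g c => simp [Representation.asAlgebraHom_single, hA _ ⟨g, rfl⟩]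

/-- Decomposition of the character and of the centralizer of a representation. -/
lemma RegularIdentity.exists_multiplicities (h : RegularIdentity R) (hn : ∀ j, 0 < n j)
    {V : Type*} [AddCommGroup V] [Module ℂ V] [FiniteDimensional ℂ V]
    (ρ : Representation ℂ G V) :
    ∃ v : ι → ℕ, (∀ g, ρ.character g = ∑ j, (v j : ℂ) * matChar R j g) ∧
      Nonempty (Subalgebra.centralizer ℂ (Set.range ρ) ≃ₐ[ℂ]
        ∀ j, Matrix (Fin (v j)) (Fin (v j)) ℂ) := by
  let Ψ := ρ.asAlgebraHom.comp h.algEquiv.symm.toAlgHom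
  let z (j : ι) : Fin (n j) := ⟨0, hn j⟩
  refine ⟨fun j => Module.finrank ℂ (multSpace Ψ z j), fun g => ?_, ?_⟩
  · have := trace_apply Ψ z fun j => R j g
    rw [show Ψ (fun j => R j g) = ρ g by simp [Ψ, h.algEquiv_symm]] at this
    exact this
  · have hr : Set.range Ψ = Set.range ρ.asAlgebraHom := by
      rw [AlgHom.coe_comp]
      exact h.algEquiv.symm.surjective.range_comp _
    obtain ⟨e⟩ := nonempty_centralizer_equiv Ψ z
    rw [hr, centralizer_range_asAlgebraHom] at e
    exact ⟨e⟩

/-- A linear relation extends to ℂ[G], where it can be evaluated on the preimage of a diagonal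
matrix unit of the i-th factor; only the i-th trace is nonzero there. -/
lemma RegularIdentity.linearIndependent (h : RegularIdentity R) (hn : ∀ j, 0 < n j) :
    LinearIndependent ℂ (matChar R) := by
  rw [Fintype.linearIndependent_iff]
  intro c hc i
  have key (x : MonoidAlgebra ℂ G) : ∑ j, c j * (groupAlgebraHom R x j).trace = 0 := by
    induction x using MonoidAlgebra.induction_linear with
    | zero => simp
    | add x y hx hy => simp [mul_add, Finset.sum_add_distrib, hx, hy]
    | single g a =>
      have := congrArg (a * ·) (congrFun hc g)
      simp only [Finset.sum_apply, Pi.smul_apply, smul_eq_mul, Finset.mul_sum, Pi.zero_apply,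
        mul_zero, matChar] at this
      simpa [groupAlgebraHom_single, mul_left_comm _ a] using this
  let z (j : ι) : Fin (n j) := ⟨0, hn j⟩
  obtain ⟨x, hx⟩ := h.bijective.2 (matUnit i (z i) (z i))
  have := key x
  rw [hx, Finset.sum_eq_single i] at this
  · simpa [matUnit] using this
  · intro j _ hj
    simp [matUnit, Pi.single_eq_of_ne hj]
  · simp

lemma RegularIdentity.coeff_unique (h : RegularIdentity R) (hn : ∀ j, 0 < n j) {v w : ι → ℂ}
    (hvw : ∀ g, ∑ j, v j * matChar R j g = ∑ j, w j * matChar R j g) : v = w := by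
  funext i
  refine sub_eq_zero.1 (Fintype.linearIndependent_iff.1 (h.linearIndependent hn) (v - w) ?_ i)
  funext g
  simpa [sub_mul, sub_eq_zero] using hvw g

/-- The representation on column vectors attached to a matrix representation. -/
def matRep {k : ℕ} (S : G →* Matrix (Fin k) (Fin k) ℂ) : Representation ℂ G (Fin k → ℂ) :=
  (Matrix.toLinAlgEquiv' : _ ≃ₐ[ℂ] Module.End ℂ (Fin k → ℂ)).toAlgHom.toMonoidHom.comp S

lemma matRep_apply {k : ℕ} (S : G →* Matrix (Fin k) (Fin k) ℂ) (g : G) :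
    matRep S g = Matrix.toLin' (S g) := rfl

lemma matRep_character {k : ℕ} (S : G →* Matrix (Fin k) (Fin k) ℂ) (g : G) :
    (matRep S).character g = (S g).trace := by
  rw [Representation.character, matRep_apply, Matrix.trace_toLin'_eq]

lemma RegularIdentity.irreducible (h : RegularIdentity R) (hn : ∀ j, 0 < n j) (i : ι) :
    (matRep (R i)).IsIrreducible := by
  have hinv (p : Subrepresentation (matRep (R i))) (A : Matrix (Fin (n i)) (Fin (n i)) ℂ)
      (v : Fin (n i) → ℂ) (hv : v ∈ p) : A.mulVec v ∈ p := by
    obtain ⟨x, hx⟩ := h.bijective.2 (Pi.single i A)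
    have : ∀ x : MonoidAlgebra ℂ G, (groupAlgebraHom R x i).mulVec v ∈ p := by
      intro x
      induction x using MonoidAlgebra.induction_linear with
      | zero =>
        rw [map_zero, Pi.zero_apply, Matrix.zero_mulVec]
        exact p.toSubmodule.zero_mem
      | add x y hx hy =>
        rw [map_add, Pi.add_apply, Matrix.add_mulVec]
        exact p.toSubmodule.add_mem hx hy
      | single g a =>
        rw [groupAlgebraHom_single, Pi.smul_apply, Matrix.smul_mulVec]
        exact p.toSubmodule.smul_mem _ (p.apply_mem_toSubmodule g hv)
    simpa [hx] using this x
  have : Nonempty (Fin (n i)) := ⟨⟨0, hn i⟩⟩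
  have : Nontrivial (Subrepresentation (matRep (R i))) := by
    refine ⟨⊥, ⊤, fun hbt => ?_⟩
    have := congrArg Subrepresentation.toSubmodule hbt
    exact bot_ne_top (α := Submodule ℂ (Fin (n i) → ℂ)) this
  refine ⟨fun p => ?_⟩
  by_cases hp : p = ⊥
  · exact Or.inl hp
  right
  have : ∃ v ∈ p, v ≠ 0 := by
    by_contra! hcon
    apply hp
    apply Subrepresentation.toSubmodule_injective
    exact (Submodule.eq_bot_iff _).2 hcon
  obtain ⟨v, hv, hv0⟩ := this
  obtain ⟨b, hb⟩ := Function.ne_iff.1 hv0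
  apply Subrepresentation.toSubmodule_injective
  refine (Submodule.eq_top_iff').2 fun w => ?_
  -- Every matrix preserves p, and this rank one matrix sends v to w.
  have := hinv p (Matrix.vecMulVec w (Pi.single b (v b)⁻¹)) v hv
  rw [Matrix.vecMulVec_mulVec] at this
  have hb' : v b ≠ 0 := hb
  have hw : w ∈ p := by simpa [hb'] using this
  exact hw

lemma RegularIdentity.isIrreducibleCharacter (h : RegularIdentity R) (hn : ∀ j, 0 < n j) (i : ι) :
    IsIrreducibleCharacter (matChar R i) :=
  ⟨n i, matRep (R i), h.irreducible hn i, funext (matRep_character (R i))⟩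

/-- A nonzero idempotent commuting with an irreducible representation is the identity. -/
lemma eq_one_of_isIdempotentElem {V : Type*} [AddCommGroup V] [Module ℂ V]
    (ρ : Representation ℂ G V) (hρ : ρ.IsIrreducible)
    (p : Subalgebra.centralizer ℂ (Set.range ρ)) (hp : p * p = p) (h0 : p ≠ 0) : p = 1 := by
  have hp' (v : V) : (p : Module.End ℂ V) ((p : Module.End ℂ V) v) = (p : Module.End ℂ V) v :=
    LinearMap.congr_fun (congrArg Subtype.val hp) v
  let W : Subrepresentation ρ := ⟨LinearMap.range (p : Module.End ℂ V), by
    rintro g _ ⟨v, rfl⟩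
    exact ⟨ρ g v, (LinearMap.congr_fun
      (Subalgebra.mem_centralizer_iff ℂ |>.1 p.2 _ ⟨g, rfl⟩) v).symm⟩⟩
  rcases hρ.eq_bot_or_eq_top W with hW | hW
  · refine absurd (Subtype.ext ?_) h0
    exact LinearMap.range_eq_bot.1 (congrArg Subrepresentation.toSubmodule hW)
  · refine Subtype.ext (LinearMap.ext fun v => ?_)
    have hv : v ∈ LinearMap.range (p : Module.End ℂ V) := by
      rw [show LinearMap.range (p : Module.End ℂ V) = ⊤ from
        congrArg Subrepresentation.toSubmodule hW]
      trivial
    obtain ⟨w, rfl⟩ := hv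
    exact hp' w

/-- The centralizer ∏ M_{v_j} of an irreducible representation has no idempotents besides 0 and 1,
which forces one v_j to be 1 and the others to be 0. -/
lemma RegularIdentity.mem_range_of_isIrreducibleCharacter (h : RegularIdentity R)
    (hn : ∀ j, 0 < n j) {f : G → ℂ} (hf : IsIrreducibleCharacter f) :
    f ∈ Set.range (matChar R) := by
  obtain ⟨k, ρ, hρ, rfl⟩ := hf
  obtain ⟨v, hv, ⟨e⟩⟩ := h.exists_multiplicities hn ρ
  have hone (q : ∀ j, Matrix (Fin (v j)) (Fin (v j)) ℂ) (hq : q * q = q) (hq0 : q ≠ 0) :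
      q = 1 := by
    have := eq_one_of_isIdempotentElem ρ hρ (e.symm q) (by rw [← map_mul, hq])
      (by simpa using hq0)
    simpa using congrArg e this
  -- If all multiplicities vanished, the centralizer would be the zero ring and the space would be
  -- zero.
  have hex : ∃ i, 0 < v i := by
    by_contra! hcon
    have hs : (1 : Subalgebra.centralizer ℂ (Set.range ρ)) = 0 := by
      apply e.injective
      funext j
      have : IsEmpty (Fin (v j)) := by
        rw [Nat.le_zero.1 (hcon j)]; infer_instance
      exact Subsingleton.elim _ _
    have hs' := congrArg Subtype.val hs
    obtain ⟨⟨W, W', hne⟩⟩ := hρ.toNontrivial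
    apply hne
    apply Subrepresentation.toSubmodule_injective
    ext w
    have : w = 0 := LinearMap.congr_fun hs' w
    simp [this]
  obtain ⟨i, hi⟩ := hex
  have hq := hone (matUnit i ⟨0, hi⟩ ⟨0, hi⟩) (matUnit_mul_same _ _ _ _) (by
    intro h0
    have := congrFun (congrFun (congrFun h0 i) ⟨0, hi⟩) ⟨0, hi⟩
    simp [matUnit] at this)
  have hvi : v i = 1 := by
    by_contra hne
    have := congrFun (congrFun (congrFun hq i) ⟨1, by omega⟩) ⟨1, by omega⟩
    simp [matUnit] at this
  have hvj (j : ι) (hj : j ≠ i) : v j = 0 := by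
    by_contra hne
    have := congrFun (congrFun (congrFun hq j) ⟨0, by omega⟩) ⟨0, by omega⟩
    simp [matUnit, Pi.single_eq_of_ne hj] at this
  refine ⟨i, funext fun g => ?_⟩
  rw [hv, Finset.sum_eq_single i]
  · simp [hvi]
  · intro j _ hj; simp [hvj j hj]
  · simp

end RegularIdentity

/-! ### Characters of tensor powers and of permutation representations. -/

section TensorPower

lemma trace_piTensorProduct_map {V : Type*} [AddCommGroup V] [Module ℂ V] [FiniteDimensional ℂ V]
    {k : ℕ} (f : Fin k → Module.End ℂ V) :
    LinearMap.trace ℂ _ (PiTensorProduct.map f) = ∏ i, LinearMap.trace ℂ V (f i) := by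
  classical
  let b := Module.finBasis ℂ V
  rw [LinearMap.trace_eq_matrix_trace ℂ (Basis.piTensorProduct fun _ : Fin k => b)]
  simp_rw [LinearMap.trace_eq_matrix_trace ℂ b, Matrix.trace, Matrix.diag_apply,
    LinearMap.toMatrix_apply]
  rw [Finset.prod_univ_sum, Fintype.piFinset_univ]
  refine Finset.sum_congr rfl fun p _ => ?_
  rw [Basis.piTensorProduct_apply, PiTensorProduct.map_tprod,
    Basis.piTensorProduct_repr_tprod_apply]

lemma character_tensorPower {G V : Type*} [Group G] [AddCommGroup V] [Module ℂ V]
    [FiniteDimensional ℂ V] (ρ : Representation ℂ G V) (k : ℕ) (g : G) :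
    (tensorPower ρ k).character g = ρ.character g ^ k := by
  have := trace_piTensorProduct_map fun _ : Fin k => ρ g
  rw [Finset.prod_const, Finset.card_univ, Fintype.card_fin] at this
  exact this

lemma character_ofMulAction {G Ω : Type*} [Group G] [MulAction G Ω] [Finite Ω] (g : G) :
    (Representation.ofMulAction ℂ G Ω).character g = permChar G Ω g := by
  classical
  have := Fintype.ofFinite Ω
  let b : Module.Basis Ω ℂ (MonoidAlgebra ℂ Ω) := ⟨MonoidAlgebra.coeffLinearEquiv ℂ⟩
  have hb (x : Ω) : b x = MonoidAlgebra.single x 1 := by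
    simp [b, Module.Basis.coe_ofRepr]
  have hr (x y : Ω) : b.repr (MonoidAlgebra.single x 1) y = if x = y then 1 else 0 := by
    rw [← hb, Module.Basis.repr_self, Finsupp.single_apply]
  rw [Representation.character, LinearMap.trace_eq_matrix_trace ℂ b, permChar, Matrix.trace]
  simp_rw [Matrix.diag_apply, LinearMap.toMatrix_apply, hb, Representation.ofMulAction_single, hr]
  rw [Finset.sum_boole, Nat.card_eq_fintype_card, Fintype.card_subtype]
  rfl

instance {Ω : Type*} [Finite Ω] : FiniteDimensional ℂ (MonoidAlgebra ℂ Ω) :=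
  Module.Finite.equiv (MonoidAlgebra.coeffLinearEquiv ℂ).symm

end TensorPower

/-! ### The model of H₁ over the field with five elements, and its representations. -/

/-- The value `p q + r s`, written for fast evaluation. -/
def dotPair (p q r s : Fin 5) : Fin 5 :=
  ⟨Nat.mod (Nat.add (Nat.mul p.1 q.1) (Nat.mul r.1 s.1)) 5, Nat.mod_lt _ (by decide)⟩

lemma dotPair_eq (p q r s : Fin 5) : dotPair p q r s = p * q + r * s := by
  apply Fin.ext
  simp only [dotPair, Fin.val_add, Fin.val_mul]
  exact Nat.add_mod _ _ _

/-- Whether a residue vanishes. -/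
def isNull (p : Fin 5) : Bool := Nat.beq p.1 0

/-- Two by two matrices over the field with five elements, row by row. -/
abbrev Quad : Type := Fin 5 × Fin 5 × Fin 5 × Fin 5

namespace Quad

/-- The matrix product. -/
def mul : Quad → Quad → Quad
  | (a, b, c, d), (e, f, g, h) =>
    (dotPair a e b g, dotPair a f b h, dotPair c e d g, dotPair c f d h)

open Fin.CommRing in
lemma mul_assoc (x y z : Quad) : mul (mul x y) z = mul x (mul y z) := by
  simp only [mul, Prod.mk.injEq, dotPair_eq]
  refine ⟨?_, ?_, ?_, ?_⟩ <;> ring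

/-- The determinant. -/
def det : Quad → Fin 5
  | (a, b, c, d) => a * d - b * c

/-- The inverse matrix, if the determinant is not zero. -/
def inv (x : Quad) : Quad :=
  -- The cube of a unit of 𝔽₅ is its inverse.
  (x.2.2.2 * (det x) ^ 3, -x.2.1 * (det x) ^ 3, -x.2.2.1 * (det x) ^ 3, x.1 * (det x) ^ 3)

/-- The monomial matrices, and the matrices with nonzero entries for which the products of the
entries along the two diagonals are opposite. -/
def good : Quad → Bool
  | (a, b, c, d) =>
    match isNull a, isNull b, isNull c, isNull d with
    | false, true, true, false => true
    | true, false, false, true => true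
    | false, false, false, false => isNull (dotPair a d b c)
    | _, _, _, _ => false

end Quad

/-- The reduction of `H₁` modulo `2 + i`. -/
def G0 : Type := {x : Quad // x.good = true}

instance : DecidableEq G0 := inferInstanceAs (DecidableEq {x : Quad // x.good = true})
instance : Fintype G0 := inferInstanceAs (Fintype {x : Quad // x.good = true})

namespace G0

lemma good_mul : ∀ x y : G0, (Quad.mul x.1 y.1).good = true := by decide +kernel

lemma good_inv : ∀ x : G0, (Quad.inv x.1).good = true := by decide +kernel

instance : Mul G0 := ⟨fun x y => ⟨Quad.mul x.1 y.1, good_mul x y⟩⟩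
instance : One G0 := ⟨⟨(1, 0, 0, 1), by decide⟩⟩
instance : Inv G0 := ⟨fun x => ⟨Quad.inv x.1, good_inv x⟩⟩

instance : Group G0 :=
  Group.ofLeftAxioms (fun x y z => Subtype.ext (Quad.mul_assoc x.1 y.1 z.1))
    (by decide +kernel) (by decide +kernel)

/-- The reduction of `T`. -/
def t : G0 := ⟨(4, 4, 4, 1), by decide⟩

/-- The reduction of `D`. -/
def d : G0 := ⟨(1, 0, 0, 2), by decide⟩

/-- The reduction of `-1`. -/
def z : G0 := ⟨(4, 0, 0, 4), by decide⟩

/-- Since t and d generate, multiplicativity of a map needs checking only for left multiplication by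
t and by d. -/
lemma exists_word : ∀ x : G0, ∃ (a : Fin 4) (b : Fin 8) (c : Fin 4) (e : Fin 2),
    x = d ^ (a : ℕ) * (t ^ (b : ℕ) * (d ^ (c : ℕ) * t ^ (e : ℕ))) := by decide +kernel

lemma closure_eq_top : Submonoid.closure {t, d} = ⊤ := by
  refine (Submonoid.eq_top_iff' _).2 fun x => ?_
  obtain ⟨a, b, c, e, rfl⟩ := exists_word x
  have ht : t ∈ Submonoid.closure {t, d} := Submonoid.subset_closure (by simp)
  have hd : d ∈ Submonoid.closure {t, d} := Submonoid.subset_closure (by simp)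
  exact mul_mem (pow_mem hd _) (mul_mem (pow_mem ht _) (mul_mem (pow_mem hd _) (pow_mem ht _)))

/-- A map that is compatible with left multiplication by the generators is a homomorphism. -/
def homOfGens {M : Type*} [Monoid M] (f : G0 → M) (h1 : f 1 = 1)
    (ht : ∀ x, f (t * x) = f t * f x) (hd : ∀ x, f (d * x) = f d * f x) : G0 →* M where
  toFun := f
  map_one' := h1
  map_mul' x y := by
    have hx : x ∈ Submonoid.closure {t, d} := by rw [closure_eq_top]; trivial
    induction hx using Submonoid.closure_induction_left with
    | one => rw [one_mul, h1, one_mul]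
    | mul_left g hg x _ ih =>
      have hg' : ∀ x, f (g * x) = f g * f x := by
        rcases hg with rfl | rfl
        exacts [ht, hd]
      rw [mul_assoc, hg', ih, hg', mul_assoc]

/-- The fourth roots of unity, from the field with five elements to the Gaussian integers. -/
def lift : Fin 5 → GaussianInt
  | 0 => 0
  | 1 => 1
  | 2 => ⟨0, 1⟩
  | 3 => ⟨0, -1⟩
  | 4 => -1

/-- The determinant. -/
def detHom : G0 →* GaussianInt :=
  homOfGens (fun x => lift x.1.det) (by decide +kernel) (by decide +kernel) (by decide +kernel)

/-- The entries of the matrix in `H₁` multiplied by `1 - i`. -/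
def entry (x : G0) (p : Fin 5) : GaussianInt :=
  -- Nonzero entries of monomial matrices are roots of unity. The other matrices have entries u / (1
  -- - i) with u a root of unity; as 1 - i reduces to 4 = 4⁻¹, u reduces to 4p.
  if (isNull x.1.1 || isNull x.1.2.1) = true then ⟨1, -1⟩ * lift p else lift (4 * p)

/-- The matrix in `H₁` multiplied by `1 - i`. -/
def scaled (x : G0) : Fin 2 → Fin 2 → GaussianInt :=
  ![![entry x x.1.1, entry x x.1.2.1], ![entry x x.1.2.2.1, entry x x.1.2.2.2]]

/-- Each `scaled` carries one factor 1 - i, so a product of two has one in excess. -/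
lemma scaled_t_mul : ∀ (x : G0) (a b : Fin 2),
    ⟨1, -1⟩ * scaled (t * x) a b = scaled t a 0 * scaled x 0 b + scaled t a 1 * scaled x 1 b := by
  decide +kernel

lemma scaled_d_mul : ∀ (x : G0) (a b : Fin 2),
    ⟨1, -1⟩ * scaled (d * x) a b = scaled d a 0 * scaled x 0 b + scaled d a 1 * scaled x 1 b := by
  decide +kernel

lemma scaled_injective : ∀ x y : G0,
    (scaled x 0 0 = scaled y 0 0 ∧ scaled x 0 1 = scaled y 0 1 ∧ scaled x 1 0 = scaled y 1 0 ∧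
      scaled x 1 1 = scaled y 1 1) → x = y := by
  decide +kernel

/-- The trace of the matrix in `H₁`. -/
def tr (x : G0) : GaussianInt :=
  let s := scaled x 0 0 + scaled x 1 1
  ⟨(s.re - s.im) / 2, (s.re + s.im) / 2⟩

/-- The halves in `tr` come from 1 / (1 - i) = (1 + i) / 2; this identity certifies that the integer
divisions are exact. -/
lemma tr_eq : ∀ x : G0, ⟨1, -1⟩ * tr x = scaled x 0 0 + scaled x 1 1 := by decide +kernel

/-- Representatives of the three coordinate axes. -/
def axis : Fin 3 → G0 :=
  ![⟨(1, 0, 0, 4), by decide⟩, ⟨(0, 1, 1, 0), by decide⟩, ⟨(0, 3, 2, 0), by decide⟩]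

/-- The signed permutation matrix of the conjugation action on the axes. -/
def rot (x : G0) (a b : Fin 3) : ℤ :=
  if x * axis b = axis a * x then 1 else if x * axis b = z * axis a * x then -1 else 0

/-- The axes are the reductions of the three Pauli matrices, which conjugation permutes up to sign.
-/
lemma rot_one : ∀ a b, rot 1 a b = if a = b then 1 else 0 := by decide +kernel

lemma rot_t_mul : ∀ (x : G0) (a b : Fin 3), rot (t * x) a b =
    rot t a 0 * rot x 0 b + rot t a 1 * rot x 1 b + rot t a 2 * rot x 2 b := by decide +kernel

lemma rot_d_mul : ∀ (x : G0) (a b : Fin 3), rot (d * x) a b =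
    rot d a 0 * rot x 0 b + rot d a 1 * rot x 1 b + rot d a 2 * rot x 2 b := by decide +kernel

/-- The rotation representation. -/
def rotHom : G0 →* Matrix (Fin 3) (Fin 3) ℤ :=
  homOfGens (fun x => Matrix.of (rot x)) (by ext a b; rw [Matrix.of_apply, rot_one, Matrix.one_apply])
    (fun x => by ext a b; simp only [Matrix.of_apply, rot_t_mul, Matrix.mul_apply, Fin.sum_univ_three])
    (fun x => by ext a b; simp only [Matrix.of_apply, rot_d_mul, Matrix.mul_apply, Fin.sum_univ_three])

/-- The action on the permutation module of the axes modulo constants. -/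
def perm (x : G0) (a b : Fin 2) : ℤ :=
  rot x a.castSucc b.castSucc ^ 2 - rot x a.castSucc 2 ^ 2

/-- Squaring removes the signs, and the columns of `perm x` are the images of e_0 - e_2 and e_1 -
e_2 in that same basis. -/
lemma perm_one : ∀ a b, perm 1 a b = if a = b then 1 else 0 := by decide +kernel

lemma perm_t_mul : ∀ (x : G0) (a b : Fin 2), perm (t * x) a b =
    perm t a 0 * perm x 0 b + perm t a 1 * perm x 1 b := by decide +kernel

lemma perm_d_mul : ∀ (x : G0) (a b : Fin 2), perm (d * x) a b =
    perm d a 0 * perm x 0 b + perm d a 1 * perm x 1 b := by decide +kernel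

/-- The two-dimensional representation through the symmetric group of the axes. -/
def permHom : G0 →* Matrix (Fin 2) (Fin 2) ℤ :=
  homOfGens (fun x => Matrix.of (perm x)) (by ext a b; rw [Matrix.of_apply, perm_one, Matrix.one_apply])
    (fun x => by ext a b; simp only [Matrix.of_apply, perm_t_mul, Matrix.mul_apply, Fin.sum_univ_two])
    (fun x => by ext a b; simp only [Matrix.of_apply, perm_d_mul, Matrix.mul_apply, Fin.sum_univ_two])

/-! ### The character table and the fixed point counts. -/

/-- The trace of the representation through the symmetric group of the axes. -/
def permTr (x : G0) : GaussianInt := (perm x 0 0 + perm x 1 1 : ℤ)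

/-- The trace of the rotation representation. -/
def rotTr (x : G0) : GaussianInt := (rot x 0 0 + rot x 1 1 + rot x 2 2 : ℤ)

/-- The character table entries of an element as a function of the determinant and of the traces
of the basic representations. -/
def charRow (e w v u : GaussianInt) : Fin 16 → GaussianInt :=
  ![1, e ^ 2, e, e ^ 3, w, e * w, e * v, e ^ 2 * v, v, e ^ 3 * v,
    e ^ 2 * u, u, e * u, e ^ 3 * u, v * w, e * (v * w)]

/-- The character table. -/
def char (x : G0) : Fin 16 → GaussianInt :=
  charRow (lift x.1.det) (permTr x) (tr x) (rotTr x)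

/-- The degrees. -/
def degree : Fin 16 → ℕ := ![1, 1, 1, 1, 2, 2, 2, 2, 2, 2, 3, 3, 3, 3, 4, 4]

/-- The generators of the point stabilizers. -/
def stabGen : Label → G0
  | .one => 1
  | .three => d ^ 2
  | .four => (t * d) ^ 2
  | .eight => (t * d) ^ 3 * d
  | .nine => d

/-- The orders of the point stabilizers. -/
def stabOrder : Label → ℕ
  | .one => 1
  | .three => 2
  | .four => 3
  | .eight => 4
  | .nine => 4

/-- The multiplicities of the irreducible characters in the five permutation characters. -/
def mult : Label → Fin 16 → ℕ
  | .one => degree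
  | .three => ![1, 1, 0, 0, 2, 0, 1, 1, 1, 1, 1, 1, 2, 2, 2, 2]
  | .four => ![1, 1, 1, 1, 0, 0, 0, 0, 0, 0, 1, 1, 1, 1, 2, 2]
  | .eight => ![1, 0, 0, 0, 1, 0, 1, 1, 0, 0, 0, 1, 1, 1, 1, 1]
  | .nine => ![1, 0, 0, 0, 1, 0, 0, 0, 1, 1, 0, 1, 1, 1, 1, 1]

lemma sum_degree_char : ∀ x : G0,
    ∑ j, (degree j : GaussianInt) * char x j = if x = 1 then 96 else 0 := by
  decide +kernel

/-- The elements of the point stabilizers. -/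
def stabList : Label → List G0
  | .one => [1]
  | .three => [⟨(1, 0, 0, 1), by decide⟩, ⟨(1, 0, 0, 4), by decide⟩]
  | .four => [⟨(1, 0, 0, 1), by decide⟩, ⟨(3, 3, 4, 1), by decide⟩, ⟨(1, 2, 1, 3), by decide⟩]
  | .eight => [⟨(1, 0, 0, 1), by decide⟩, ⟨(4, 0, 0, 3), by decide⟩, ⟨(1, 0, 0, 4), by decide⟩,
      ⟨(4, 0, 0, 2), by decide⟩]
  | .nine => [⟨(1, 0, 0, 1), by decide⟩, ⟨(1, 0, 0, 2), by decide⟩, ⟨(1, 0, 0, 4), by decide⟩,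
      ⟨(1, 0, 0, 3), by decide⟩]

lemma stabGen_pow_stabOrder (i : Label) : stabGen i ^ stabOrder i = 1 := by
  cases i <;> decide +kernel

lemma stabOrder_pos (i : Label) : 0 < stabOrder i := by cases i <;> decide

lemma mem_stabList_iff (i : Label) (x : G0) :
    x ∈ stabList i ↔ ∃ n < stabOrder i, stabGen i ^ n = x := by
  revert x
  cases i <;> decide +kernel

lemma mem_zpowers_stabGen_iff (i : Label) (x : G0) :
    x ∈ Subgroup.zpowers (stabGen i) ↔ x ∈ stabList i := by
  rw [mem_stabList_iff, ← mem_powers_iff_mem_zpowers, Submonoid.mem_powers_iff]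
  refine ⟨fun ⟨n, hn⟩ => ⟨n % stabOrder i, Nat.mod_lt _ (stabOrder_pos i), ?_⟩,
    fun ⟨n, _, hn⟩ => ⟨n, hn⟩⟩
  rw [← pow_eq_pow_mod n (stabGen_pow_stabOrder i), hn]

lemma stabList_nodup (i : Label) : (stabList i).Nodup := by cases i <;> decide +kernel

lemma stabList_length (i : Label) : (stabList i).length = stabOrder i := by cases i <;> rfl

lemma card_zpowers_stabGen (i : Label) :
    Nat.card (Subgroup.zpowers (stabGen i)) = stabOrder i := by
  rw [← stabList_length, ← List.toFinset_card_of_nodup (stabList_nodup i)]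
  refine Nat.subtype_card _ fun x => ?_
  rw [List.mem_toFinset, mem_zpowers_stabGen_iff]

/-- The number of elements that conjugate `x` into a list of elements. -/
def conjCount (ks : List G0) (x : G0) : ℕ :=
  (Finset.univ.filter fun y : G0 => ∃ k ∈ ks, x * y = y * k).card

/-- Trace and determinant over the field with five elements. -/
def trDet (x : G0) : Fin 5 × Fin 5 := (x.1.1 + x.1.2.2.2, x.1.det)

open Fin.CommRing in
lemma trDet_mul_comm (x y : G0) : trDet (x * y) = trDet (y * x) := by
  change (_, (Quad.mul x.1 y.1).det) = ((Quad.mul y.1 x.1).1 + (Quad.mul y.1 x.1).2.2.2,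
    (Quad.mul y.1 x.1).det)
  refine Prod.ext ?_ ?_
  · change (Quad.mul x.1 y.1).1 + (Quad.mul x.1 y.1).2.2.2 = _
    simp only [Quad.mul, dotPair_eq]
    ring
  · simp only [Quad.mul, Quad.det, dotPair_eq]
    ring

/-- Conjugate elements share trace and determinant; discarding the other candidates keeps the
exhaustive count small. -/
lemma conjCount_filter (ks : List G0) (x : G0) :
    conjCount (ks.filter fun k => trDet x = trDet k) x = conjCount ks x := by
  refine congrArg Finset.card (Finset.filter_congr fun y _ => ?_)
  simp only [List.mem_filter, decide_eq_true_eq]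
  refine ⟨fun ⟨k, hk, h⟩ => ⟨k, hk.1, h⟩, fun ⟨k, hk, h⟩ => ⟨k, ⟨hk, ?_⟩, h⟩⟩
  rw [← inv_mul_cancel_left y k, ← h, trDet_mul_comm, mul_inv_cancel_right]

/-- A coset yK is fixed by x exactly when y⁻¹xy ∈ K, so the left side is |K| times the number of
fixed cosets. The check thus certifies the decomposition of θ_i. -/
lemma conjCount_stabList (i : Label) (x : G0) :
    (conjCount (stabList i) x : GaussianInt) =
      (stabOrder i : GaussianInt) * ∑ j, (mult i j : GaussianInt) * char x j := by
  rw [← conjCount_filter]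
  revert x
  cases i <;> decide +kernel

/-- The number of cosets of a point stabilizer. -/
def index (i : Label) : ℕ := 96 / stabOrder i

/-- The number of fixed points of the nontrivial elements with fixed points. -/
def fix : Label → ℕ
  | .one => 1
  | .three => 8
  | .four => 8
  | .eight => 4
  | .nine => 4

lemma sum_mult_char (i : Label) (x : G0) :
    (x = 1 ∧ ∑ j, (mult i j : GaussianInt) * char x j = index i) ∨
    (x ≠ 1 ∧ (∑ j, (mult i j : GaussianInt) * char x j = 0 ∨
      ∑ j, (mult i j : GaussianInt) * char x j = fix i)) := by
  revert x
  cases i <;> decide +kernel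

/-- A power of `x` is the central involution. -/
def Bad (x : G0) : Prop := x ^ 3 = z ∨ x ^ 6 = z ∨ x ^ 12 = z

instance (x : G0) : Decidable (Bad x) := inferInstanceAs (Decidable (_ ∨ _ ∨ _))

/-- The element is conjugate to a generator of a cyclic group of order four without the central
involution. -/
def ConjFour (x : G0) : Prop :=
  ∃ y, x * y = y * d ∨ x * y = y * d ^ 3 ∨ x * y = y * (z * d) ∨ x * y = y * (z * d ^ 3)

instance (x : G0) : Decidable (ConjFour x) :=
  inferInstanceAs (Decidable (∃ _, _ ∨ _ ∨ _ ∨ _))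

/-- Element orders divide 24, so if -1 is a power of x, it is already one of the powers 3, 6, 12 of
`Bad`. The other alternatives are all that a subgroup without -1 can contain. -/
lemma bad_or_conj : ∀ x : G0, Bad x ∨ x = 1 ∨ ConjFour x ∨
    ∃ y, x * y = y * (t * d) ^ 2 ∨ x * y = y * d ^ 2 := by decide +kernel

/-- Consequently ⟨d⟩ is maximal among the subgroups avoiding -1: adjoining any x outside it produces
an element with -1 as a power. -/
lemma bad_of_d : ∀ x : G0, Bad x ∨ x ∈ stabList .nine ∨ Bad (d * x) ∨ Bad (d ^ 2 * x) ∨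
    Bad (d ^ 3 * x) := by decide +kernel

lemma bad_of_neg_d : ∀ x : G0, Bad x ∨ x ∈ stabList .eight ∨ Bad (z * d * x) ∨
    Bad ((z * d) ^ 2 * x) ∨ Bad ((z * d) ^ 3 * x) := by decide +kernel

lemma bad_of_td : ∀ x : G0, Bad x ∨ x ∈ stabList .four ∨ Bad ((t * d) ^ 2 * x) ∨
    Bad (((t * d) ^ 2) ^ 2 * x) := by decide +kernel

/-- The alternative `ConjFour` is needed because ⟨d²⟩ is not maximal: it lies in ⟨d⟩ and ⟨-d⟩. -/
lemma bad_of_d_sq : ∀ x : G0, Bad x ∨ x ∈ stabList .three ∨ Bad (d ^ 2 * x) ∨ ConjFour x := by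
  decide +kernel

/-! ### The isomorphism of the model with H₁. -/

lemma one_sub_I_ne_zero : (1 - Complex.I) ≠ 0 := by
  intro h
  have := congrArg Complex.re h
  simp at this

lemma toComplex_one_sub_I : GaussianInt.toComplex ⟨1, -1⟩ = 1 - Complex.I := by
  simp [GaussianInt.toComplex_def, sub_eq_add_neg]

/-- The matrix in `H₁` with a given reduction. -/
def matV (x : G0) : Matrix (Fin 2) (Fin 2) ℂ :=
  Matrix.of fun a b => (1 - Complex.I)⁻¹ * GaussianInt.toComplex (scaled x a b)

lemma scaled_one : ∀ a b, scaled 1 a b = if a = b then ⟨1, -1⟩ else 0 := by decide +kernel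

lemma matV_mul {g x : G0} (h : ∀ a b : Fin 2, ⟨1, -1⟩ * scaled (g * x) a b =
    scaled g a 0 * scaled x 0 b + scaled g a 1 * scaled x 1 b) :
    matV (g * x) = matV g * matV x := by
  ext a b
  have := congrArg GaussianInt.toComplex (h a b)
  rw [map_mul, toComplex_one_sub_I, map_add, map_mul, map_mul] at this
  have h0 := one_sub_I_ne_zero
  simp only [matV, Matrix.mul_apply, Matrix.of_apply, Fin.sum_univ_two]
  field_simp
  linear_combination this

/-- The inverse of the reduction, as a matrix representation. -/
def matVHom : G0 →* Matrix (Fin 2) (Fin 2) ℂ :=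
  homOfGens matV
    (by
      ext a b
      rw [matV, Matrix.of_apply, scaled_one, Matrix.one_apply]
      split_ifs
      · rw [toComplex_one_sub_I, inv_mul_cancel₀ one_sub_I_ne_zero]
      · simp)
    (fun x => matV_mul (scaled_t_mul x)) (fun x => matV_mul (scaled_d_mul x))

lemma matVHom_injective : Function.Injective matVHom := by
  intro x y h
  have h' (a b : Fin 2) : scaled x a b = scaled y a b := by
    have := congrFun (congrFun h a) b
    exact GaussianInt.toComplex_injective
      (mul_left_cancel₀ (inv_ne_zero one_sub_I_ne_zero) this)
  exact scaled_injective x y ⟨h' 0 0, h' 0 1, h' 1 0, h' 1 1⟩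

lemma trace_matVHom (x : G0) : (matVHom x).trace = GaussianInt.toComplex (tr x) := by
  have := congrArg GaussianInt.toComplex (tr_eq x)
  rw [map_mul, toComplex_one_sub_I, map_add] at this
  have h0 := one_sub_I_ne_zero
  rw [Matrix.trace_fin_two]
  change (1 - Complex.I)⁻¹ * _ + (1 - Complex.I)⁻¹ * _ = _
  rw [← mul_add, ← this, inv_mul_cancel_left₀ h0]

/-- The inverse of the reduction, as a homomorphism to the general linear group. -/
def toGL : G0 →* Matrix.GeneralLinearGroup (Fin 2) ℂ := matVHom.toHomUnits

lemma toGL_injective : Function.Injective toGL := fun _ _ h =>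
  matVHom_injective (congrArg Units.val h)

lemma toGL_t : toGL t = matT := by
  refine Units.ext (Matrix.ext fun a b => ?_)
  have h (a b : Fin 2) : scaled t a b = ![![1, 1], ![1, -1]] a b := by
    revert a b; decide +kernel
  change (1 - Complex.I)⁻¹ * GaussianInt.toComplex (scaled t a b) =
    (((1 + Complex.I) / 2) • !![1, 1; 1, -1] : Matrix (Fin 2) (Fin 2) ℂ) a b
  have hi : (1 - Complex.I)⁻¹ = (1 + Complex.I) / 2 := by
    rw [inv_eq_iff_eq_inv, eq_comm, inv_eq_of_mul_eq_one_right]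
    linear_combination (-1 / 2 : ℂ) * Complex.I_mul_I
  rw [h, hi]
  fin_cases a <;> fin_cases b <;> simp

lemma toGL_d : toGL d = matD := by
  refine Units.ext (Matrix.ext fun a b => ?_)
  have h (a b : Fin 2) : scaled d a b = ⟨1, -1⟩ * ![![1, 0], ![0, ⟨0, 1⟩]] a b := by
    revert a b; decide +kernel
  change (1 - Complex.I)⁻¹ * GaussianInt.toComplex (scaled d a b) =
    (!![1, 0; 0, Complex.I] : Matrix (Fin 2) (Fin 2) ℂ) a b
  rw [h, map_mul, toComplex_one_sub_I, inv_mul_cancel_left₀ one_sub_I_ne_zero]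
  fin_cases a <;> fin_cases b <;> simp [GaussianInt.toComplex_def]

lemma range_toGL : toGL.range = H1 := by
  have htop : Subgroup.closure {t, d} = (⊤ : Subgroup G0) := by
    refine (Subgroup.eq_top_iff' _).2 fun x => ?_
    have hx : x ∈ Submonoid.closure {t, d} := by rw [closure_eq_top]; trivial
    exact Subgroup.le_closure_toSubmonoid _ hx
  rw [MonoidHom.range_eq_map, ← htop, MonoidHom.map_closure, Set.image_pair, toGL_t, toGL_d, H1]

/-- The inverse of the reduction. -/
def iso : G0 ≃* H1 :=
  (MonoidHom.ofInjective toGL_injective).trans (MulEquiv.subgroupCongr range_toGL)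

lemma iso_t : iso t = CentralizerH1.t := Subtype.ext toGL_t

lemma iso_d : iso d = CentralizerH1.d := Subtype.ext toGL_d

lemma map_zpowers_stabGen (i : Label) :
    (Subgroup.zpowers (stabGen i)).map iso.toMonoidHom = stab i := by
  rw [MonoidHom.map_zpowers]
  cases i <;> simp [stabGen, stab, iso_t, iso_d]

lemma iso_mem_stab (i : Label) (x : G0) : iso x ∈ stab i ↔ x ∈ Subgroup.zpowers (stabGen i) := by
  rw [← map_zpowers_stabGen]
  exact Subgroup.mem_map_iff_mem iso.injective

end G0

instance : Fintype H1 := Fintype.ofEquiv G0 G0.iso.toEquiv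

/-! ### Permutation characters and irreducible representations of H₁. -/

/-- Counting fixed points on cosets. -/
lemma card_fixedBy_quotient {G : Type*} [Group G] (K : Subgroup G) (g : G) :
    Nat.card K * Nat.card (MulAction.fixedBy (G ⧸ K) g) =
      Nat.card {y : G // y⁻¹ * g * y ∈ K} := by
  rw [← Nat.card_prod, ← Nat.card_congr (QuotientGroup.preimageMkEquivSubgroupProdSet K _)]
  refine Nat.card_congr (Equiv.subtypeEquivRight fun y => ?_)
  rw [Set.mem_preimage, MulAction.mem_fixedBy, MulAction.Quotient.smul_mk, eq_comm,
    QuotientGroup.eq, smul_eq_mul, mul_assoc]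

namespace G0

lemma θ_iso (i : Label) (x : G0) :
    θ i (iso x) = GaussianInt.toComplex (∑ j, (mult i j : GaussianInt) * char x j) := by
  have hK : Nat.card (stab i) = stabOrder i := by
    rw [← card_zpowers_stabGen, ← map_zpowers_stabGen]
    exact Subgroup.card_map_of_injective iso.injective
  have h1 := card_fixedBy_quotient (stab i) (iso x)
  have h2 : Nat.card {y : H1 // y⁻¹ * iso x * y ∈ stab i} = conjCount (stabList i) x := by
    rw [← Nat.card_congr (iso.toEquiv.subtypeEquiv (p := fun y => y⁻¹ * x * y ∈
      Subgroup.zpowers (stabGen i)) fun y => ?_)]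
    · refine Nat.subtype_card _ fun y => ?_
      rw [Finset.mem_filter, mem_zpowers_stabGen_iff]
      simp only [Finset.mem_univ, true_and]
      refine ⟨fun ⟨k, hk, h⟩ => ?_, fun h => ⟨_, h, by group⟩⟩
      rwa [mul_assoc, h, inv_mul_cancel_left]
    · rw [← iso_mem_stab]
      simp
  rw [h2, hK] at h1
  have h3 := congrArg GaussianInt.toComplex (conjCount_stabList i x)
  rw [← h1, map_natCast, map_mul, map_natCast, Nat.cast_mul] at h3
  have h0 : (stabOrder i : ℂ) ≠ 0 := by exact_mod_cast (stabOrder_pos i).ne'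
  exact mul_left_cancel₀ h0 h3

/-- The determinant character. -/
def detC : G0 →* ℂ := (GaussianInt.toComplex : GaussianInt →* ℂ).comp detHom

/-- The tensor product with a power of the determinant character. -/
def twist {n : ℕ} (k : ℕ) (S : G0 →* Matrix (Fin n) (Fin n) ℂ) :
    G0 →* Matrix (Fin n) (Fin n) ℂ where
  toFun x := detC x ^ k • S x
  map_one' := by simp
  map_mul' x y := by
    rw [map_mul, map_mul, mul_pow, smul_mul_smul_comm]

lemma trace_twist {n : ℕ} (k : ℕ) (S : G0 →* Matrix (Fin n) (Fin n) ℂ) (x : G0) :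
    (twist k S x).trace = detC x ^ k * (S x).trace := Matrix.trace_smul _ _

/-- Complexification of an integral representation. -/
def complexify {n : ℕ} (S : G0 →* Matrix (Fin n) (Fin n) ℤ) : G0 →* Matrix (Fin n) (Fin n) ℂ :=
  (Int.castRingHom ℂ).mapMatrix.toMonoidHom.comp S

lemma trace_complexify {n : ℕ} (S : G0 →* Matrix (Fin n) (Fin n) ℤ) (x : G0) :
    (complexify S x).trace = ((S x).trace : ℂ) := by
  simp [complexify, Matrix.trace]

/-- The tensor product of the reflection representation and of the representation through the
symmetric group of the axes. -/
def tensorHom : G0 →* Matrix (Fin 4) (Fin 4) ℂ where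
  toFun x := Matrix.reindexAlgEquiv ℂ ℂ finProdFinEquiv
    (Matrix.kronecker (matVHom x) (complexify permHom x))
  map_one' := by
    rw [map_one, map_one, Matrix.kronecker, Matrix.one_kronecker_one, map_one]
  map_mul' x y := by
    rw [map_mul, map_mul, Matrix.kronecker, Matrix.mul_kronecker_mul, map_mul]

lemma trace_tensorHom (x : G0) :
    (tensorHom x).trace = (matVHom x).trace * (complexify permHom x).trace := by
  rw [← Matrix.trace_kronecker]
  exact Equiv.sum_comp finProdFinEquiv.symm fun p =>
    Matrix.kronecker (matVHom x) (complexify permHom x) p p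

/-- The irreducible representations. -/
def irrep : Fin 16 → Σ n, G0 →* Matrix (Fin n) (Fin n) ℂ :=
  ![⟨1, 1⟩, ⟨1, twist 2 1⟩, ⟨1, twist 1 1⟩, ⟨1, twist 3 1⟩,
    ⟨2, complexify permHom⟩, ⟨2, twist 1 (complexify permHom)⟩,
    ⟨2, twist 1 matVHom⟩, ⟨2, twist 2 matVHom⟩, ⟨2, matVHom⟩, ⟨2, twist 3 matVHom⟩,
    ⟨3, twist 2 (complexify rotHom)⟩, ⟨3, complexify rotHom⟩, ⟨3, twist 1 (complexify rotHom)⟩,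
    ⟨3, twist 3 (complexify rotHom)⟩, ⟨4, tensorHom⟩, ⟨4, twist 1 tensorHom⟩]

lemma irrep_fst (j : Fin 16) : (irrep j).1 = degree j := by
  fin_cases j <;> rfl

lemma trace_irrep (j : Fin 16) (x : G0) :
    ((irrep j).2 x).trace = GaussianInt.toComplex (char x j) := by
  have hd : detC x = GaussianInt.toComplex (lift x.1.det) := rfl
  have hw : (complexify permHom x).trace = GaussianInt.toComplex (permTr x) := by
    rw [trace_complexify, permTr, map_intCast, Matrix.trace_fin_two]; rfl
  have hu : (complexify rotHom x).trace = GaussianInt.toComplex (rotTr x) := by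
    rw [trace_complexify, rotTr, map_intCast, Matrix.trace_fin_three]; rfl
  have hv := trace_matVHom x
  have hx := trace_tensorHom x
  rw [hv, hw, ← map_mul] at hx
  have h1 : ((1 : G0 →* Matrix (Fin 1) (Fin 1) ℂ) x).trace = GaussianInt.toComplex 1 := by simp
  have tw {n k : ℕ} {S : G0 →* Matrix (Fin n) (Fin n) ℂ} {c c' : GaussianInt}
      (h : (S x).trace = GaussianInt.toComplex c) (hc : lift x.1.det ^ k * c = c') :
      (twist k S x).trace = GaussianInt.toComplex c' := by
    rw [trace_twist, h, hd, ← map_pow, ← map_mul, hc]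
  fin_cases j
  exacts [h1, tw h1 (mul_one _), tw h1 (by rw [pow_one]; exact mul_one _), tw h1 (mul_one _),
    hw, tw hw (by rw [pow_one]; rfl), tw hv (by rw [pow_one]; rfl), tw hv rfl, hv, tw hv rfl,
    tw hu rfl, hu, tw hu (by rw [pow_one]; rfl), tw hu rfl, hx, tw hx (by rw [pow_one]; rfl)]

end G0

/-- The matrix forms of the irreducible representations of `H₁`. -/
def irrepH1 (j : Fin 16) : H1 →* Matrix (Fin (G0.irrep j).1) (Fin (G0.irrep j).1) ℂ :=
  (G0.irrep j).2.comp G0.iso.symm.toMonoidHom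

lemma matChar_irrepH1 (j : Fin 16) (x : G0) :
    matChar irrepH1 j (G0.iso x) = GaussianInt.toComplex (G0.char x j) := by
  rw [← G0.trace_irrep, matChar, irrepH1]
  simp

open Classical in
lemma regularIdentity_irrepH1 : RegularIdentity irrepH1 := by
  intro g
  obtain ⟨x, rfl⟩ := G0.iso.surjective g
  have hc : Fintype.card H1 = 96 := by
    rw [← Fintype.card_congr G0.iso.toEquiv]
    decide +kernel
  have := congrArg GaussianInt.toComplex (G0.sum_degree_char x)
  rw [map_sum] at this
  have h1 : G0.iso x = 1 ↔ x = 1 := by simp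
  simp only [h1, hc]
  rw [apply_ite GaussianInt.toComplex, map_zero, map_ofNat] at this
  push_cast
  rw [← this]
  refine Finset.sum_congr rfl fun j _ => ?_
  rw [map_mul, map_natCast, ← matChar_irrepH1, ← G0.irrep_fst]
  rfl

lemma degree_irrepH1_pos (j : Fin 16) : 0 < (G0.irrep j).1 := by
  rw [G0.irrep_fst]
  revert j
  decide

/-! ### Classification of the faithful transitive actions. -/

namespace G0

/-- A conjugate of a subgroup. -/
def conjSub (K : Subgroup G0) (y : G0) : Subgroup G0 := K.comap (MulAut.conj y).toMonoidHom

lemma mem_conjSub {K : Subgroup G0} {y x : G0} : x ∈ conjSub K y ↔ y * x * y⁻¹ ∈ K := Iff.rfl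

lemma mem_conjSub_of_mul_eq {K : Subgroup G0} {x y k : G0} (hx : x ∈ K) (h : x * y = y * k) :
    k ∈ conjSub K y := by
  rwa [mem_conjSub, ← h, mul_inv_cancel_right]

lemma z_mul : ∀ x : G0, z * x = x * z := by decide +kernel

lemma z_ne_one : z ≠ 1 := by decide +kernel

lemma not_bad {K : Subgroup G0} (hz : z ∉ K) {y x : G0} (hx : x ∈ conjSub K y) : ¬ Bad x := by
  have hz' : z ∉ conjSub K y := by
    rwa [mem_conjSub, ← z_mul, mul_inv_cancel_right]
  rintro (h | h | h) <;> exact hz' (h ▸ pow_mem hx _)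

lemma ConjFour.conj {x : G0} (h : ConjFour x) (y : G0) : ConjFour (y * x * y⁻¹) := by
  obtain ⟨u, hu⟩ := h
  refine ⟨y * u, ?_⟩
  have key (k : G0) (hk : x * u = u * k) : y * x * y⁻¹ * (y * u) = y * u * k := by
    rw [mul_assoc y u k, ← hk]; group
  exact hu.imp (key _) (Or.imp (key _) (Or.imp (key _) (key _)))

lemma stabGen_eight : stabGen .eight = z * d := by decide +kernel

lemma stabGen_facts : (d ^ 3) ^ 3 = d ∧ (z * d ^ 3) ^ 3 = z * d := by decide +kernel

/-- A subgroup without the central involution is conjugate to one of the five stabilizers. -/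
lemma exists_conj {K : Subgroup G0} (hz : z ∉ K) :
    ∃ i y, conjSub K y = Subgroup.zpowers (stabGen i) := by
  suffices h : ∃ i y, stabGen i ∈ conjSub K y ∧ ∀ x ∈ conjSub K y, x ∈ stabList i by
    obtain ⟨i, y, hg, hl⟩ := h
    refine ⟨i, y, le_antisymm (fun x hx => ?_) ((Subgroup.zpowers_le).2 hg)⟩
    exact (mem_zpowers_stabGen_iff i x).2 (hl x hx)
  have nine (y : G0) (hy : d ∈ conjSub K y) (x : G0) (hx : x ∈ conjSub K y) :
      x ∈ stabList .nine := by
    rcases bad_of_d x with h | h | h | h | h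
    exacts [absurd h (not_bad hz hx), h, absurd h (not_bad hz (mul_mem hy hx)),
      absurd h (not_bad hz (mul_mem (pow_mem hy _) hx)),
      absurd h (not_bad hz (mul_mem (pow_mem hy _) hx))]
  have eight (y : G0) (hy : z * d ∈ conjSub K y) (x : G0) (hx : x ∈ conjSub K y) :
      x ∈ stabList .eight := by
    rcases bad_of_neg_d x with h | h | h | h | h
    exacts [absurd h (not_bad hz hx), h, absurd h (not_bad hz (mul_mem hy hx)),
      absurd h (not_bad hz (mul_mem (pow_mem hy _) hx)),
      absurd h (not_bad hz (mul_mem (pow_mem hy _) hx))]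
  -- The largest stabilizers come first: the failure of h4 later excludes `ConjFour` in the case of
  -- ⟨d²⟩.
  by_cases h4 : ∃ x ∈ K, ConjFour x
  · obtain ⟨x, hx, y, h | h | h | h⟩ := h4
    · have hy := mem_conjSub_of_mul_eq hx h
      exact ⟨.nine, y, hy, nine y hy⟩
    -- Cubing passes from the inverse generator d³ to d.
    · have hy := pow_mem (mem_conjSub_of_mul_eq hx h) 3
      rw [stabGen_facts.1] at hy
      exact ⟨.nine, y, hy, nine y hy⟩
    · have hy := mem_conjSub_of_mul_eq hx h
      exact ⟨.eight, y, stabGen_eight ▸ hy, eight y hy⟩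
    · have hy := pow_mem (mem_conjSub_of_mul_eq hx h) 3
      rw [stabGen_facts.2] at hy
      exact ⟨.eight, y, stabGen_eight ▸ hy, eight y hy⟩
  by_cases h3 : ∃ x ∈ K, ∃ y, x * y = y * (t * d) ^ 2
  · obtain ⟨x, hx, y, h⟩ := h3
    have hy := mem_conjSub_of_mul_eq hx h
    refine ⟨.four, y, hy, fun x hx => ?_⟩
    rcases bad_of_td x with h | h | h | h
    exacts [absurd h (not_bad hz hx), h, absurd h (not_bad hz (mul_mem hy hx)),
      absurd h (not_bad hz (mul_mem (pow_mem hy _) hx))]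
  by_cases h2 : ∃ x ∈ K, ∃ y, x * y = y * d ^ 2
  · obtain ⟨x, hx, y, h⟩ := h2
    have hy := mem_conjSub_of_mul_eq hx h
    refine ⟨.three, y, hy, fun x hx => ?_⟩
    rcases bad_of_d_sq x with h | h | h | h
    exacts [absurd h (not_bad hz hx), h, absurd h (not_bad hz (mul_mem hy hx)),
      absurd ⟨_, hx, h.conj y⟩ h4]
  refine ⟨.one, 1, one_mem _, fun x hx => ?_⟩
  have hxK : x ∈ K := by simpa [mem_conjSub] using hx
  rcases bad_or_conj x with h | h | h | ⟨y, h | h⟩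
  exacts [absurd h (not_bad hz hx), List.mem_singleton.2 h, absurd ⟨_, hxK, h⟩ h4,
    absurd ⟨_, hxK, y, h⟩ h3, absurd ⟨_, hxK, y, h⟩ h2]

lemma θ_one (i : Label) : θ i 1 = index i := by
  rw [← map_one iso, θ_iso]
  rcases sum_mult_char i 1 with h | h
  · rw [h.2, map_natCast]
  · exact absurd rfl h.1

lemma θ_of_ne_one (i : Label) {x : G0} (hx : x ≠ 1) : θ i (iso x) = 0 ∨ θ i (iso x) = fix i := by
  rw [θ_iso]
  rcases sum_mult_char i x with h | ⟨-, h | h⟩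
  · exact absurd h.1 hx
  · left; rw [h, map_zero]
  · right; rw [h, map_natCast]

lemma θ_eight_ne_nine : θ .eight ≠ θ .nine := by
  intro h
  have := congrFun h (iso d)
  rw [θ_iso, θ_iso, GaussianInt.toComplex_inj] at this
  revert this
  decide +kernel

/-- The numbers of points 96, 48, 32, 24, 24 separate all but the last two characters, which differ
at d. -/
lemma θ_injective : Function.Injective θ := by
  intro i j h
  have h1 := congrFun h 1
  rw [θ_one, θ_one, Nat.cast_inj] at h1
  cases i <;> cases j <;>
    first
    | rfl
    | exact absurd h θ_eight_ne_nine
    | exact absurd h.symm θ_eight_ne_nine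
    | exact absurd h1 (by decide)

end G0

lemma permChar_eq_of_permEquiv {G Ω Ω' : Type*} [Group G] [MulAction G Ω] [MulAction G Ω']
    (h : PermEquiv G Ω Ω') : permChar G Ω = permChar G Ω' := by
  obtain ⟨f, hf⟩ := h
  funext g
  refine congrArg Nat.cast (Nat.card_congr (f.subtypeEquiv fun x => ?_))
  rw [MulAction.mem_fixedBy, MulAction.mem_fixedBy, ← hf, f.injective.eq_iff]

lemma permEquiv_quotient_stabilizer {G Ω : Type*} [Group G] [MulAction G Ω]
    [MulAction.IsPretransitive G Ω] (x : Ω) :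
    PermEquiv G Ω (G ⧸ MulAction.stabilizer G x) := by
  let f : G ⧸ MulAction.stabilizer G x ≃ Ω :=
    Equiv.ofBijective (MulAction.ofQuotientStabilizer G x)
      ⟨MulAction.injective_ofQuotientStabilizer G x, fun y => by
        obtain ⟨g, rfl⟩ := MulAction.exists_smul_eq G x y
        exact ⟨(g : G ⧸ MulAction.stabilizer G x), rfl⟩⟩
  refine ⟨f.symm, fun g y => ?_⟩
  rw [Equiv.symm_apply_eq]
  change _ = MulAction.ofQuotientStabilizer G x _
  rw [MulAction.ofQuotientStabilizer_smul]
  exact congrArg (g • ·) (f.apply_symm_apply y).symm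

/-- An element of the kernel fixes every point, but a nontrivial element fixes either 0 or `fix i`
points, both fewer than `index i`. -/
lemma faithfulSMul_quotient_stab (i : Label) : FaithfulSMul H1 (H1 ⧸ stab i) := by
  refine ⟨fun {g g'} h => ?_⟩
  obtain ⟨x, hx⟩ := G0.iso.surjective (g'⁻¹ * g)
  by_contra hne
  have hx1 : x ≠ 1 := by
    rintro rfl
    rw [map_one] at hx
    exact hne (inv_mul_eq_one.1 hx.symm).symm
  have hθ : θ i (G0.iso x) = θ i 1 := by
    rw [hx]
    refine congrArg Nat.cast (Nat.card_congr (Equiv.subtypeEquivRight fun q => ?_))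
    rw [MulAction.mem_fixedBy, MulAction.mem_fixedBy, mul_smul, h, inv_smul_smul, one_smul]
  rw [G0.θ_one] at hθ
  rcases G0.θ_of_ne_one i hx1 with h0 | h0 <;> rw [h0] at hθ
  · have : 0 = G0.index i := by exact_mod_cast hθ
    revert this
    cases i <;> decide
  · have : G0.fix i = G0.index i := by exact_mod_cast hθ
    revert this
    cases i <;> decide

lemma existsUnique_permEquiv (Ω : Type*) [MulAction H1 Ω] [FaithfulSMul H1 Ω]
    [MulAction.IsPretransitive H1 Ω] : ∃! i : Label, PermEquiv H1 Ω (H1 ⧸ stab i) := by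
  have hz1 : G0.iso G0.z ≠ 1 := by
    rw [Ne, EmbeddingLike.map_eq_one_iff]
    exact G0.z_ne_one
  -- Pretransitivity allows the empty set; faithfulness excludes it because the group is nontrivial.
  obtain ⟨x⟩ : Nonempty Ω := by
    by_contra hne
    rw [not_nonempty_iff] at hne
    exact hz1 (FaithfulSMul.eq_of_smul_eq_smul (α := Ω) fun a => isEmptyElim a)
  let K : Subgroup G0 := (MulAction.stabilizer H1 x).comap G0.iso.toMonoidHom
  -- A central element fixing one point of a transitive set fixes all of them.
  have hz : G0.z ∉ K := by
    intro hz
    refine hz1 (FaithfulSMul.eq_of_smul_eq_smul (α := Ω) fun a => ?_)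
    obtain ⟨g, rfl⟩ := MulAction.exists_smul_eq H1 x a
    obtain ⟨w, rfl⟩ := G0.iso.surjective g
    have hzx : G0.iso G0.z • x = x := hz
    rw [smul_smul, ← map_mul, G0.z_mul, map_mul, mul_smul, hzx, one_smul]
  obtain ⟨i, y, hi⟩ := G0.exists_conj hz
  have hst : MulAction.stabilizer H1 ((G0.iso y)⁻¹ • x) = stab i := by
    ext g
    obtain ⟨w, rfl⟩ := G0.iso.surjective g
    rw [G0.iso_mem_stab, ← hi, G0.mem_conjSub, MulAction.mem_stabilizer_iff, eq_inv_smul_iff,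
      smul_smul, smul_smul, ← map_inv, ← map_mul, ← map_mul]
    rfl
  have hΩ := permEquiv_quotient_stabilizer (G := H1) ((G0.iso y)⁻¹ • x)
  rw [hst] at hΩ
  refine ⟨i, hΩ, fun j hj => G0.θ_injective ?_⟩
  exact (permChar_eq_of_permEquiv hj).symm.trans (permChar_eq_of_permEquiv hΩ)

/-! ### Multiplicities in the powers of the permutation characters. -/

/-- The irreducible characters of `H₁`. -/
def chi : Fin 16 → H1 → ℂ := matChar irrepH1

lemma sum_mult_chi (i : Label) (g : H1) : ∑ j, (G0.mult i j : ℂ) * chi j g = θ i g := by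
  obtain ⟨x, rfl⟩ := G0.iso.surjective g
  rw [G0.θ_iso, map_sum]
  exact Finset.sum_congr rfl fun j _ => by rw [chi, matChar_irrepH1, map_mul, map_natCast]

lemma sum_degree_chi (x : G0) :
    ∑ j, (G0.degree j : ℂ) * chi j (G0.iso x) = if x = 1 then 96 else 0 := by
  have := congrArg GaussianInt.toComplex (G0.sum_degree_char x)
  rw [map_sum, apply_ite GaussianInt.toComplex, map_zero, map_ofNat] at this
  rw [← this]
  exact Finset.sum_congr rfl fun j _ => by rw [chi, matChar_irrepH1, map_mul, map_natCast]

/-- The multiplicities in the powers of the permutation characters. -/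
def powMult (i : Label) (k : ℕ) (j : Fin 16) : ℚ :=
  G0.fix i ^ k * G0.mult i j +
    (G0.index i ^ (k + 1) - G0.fix i ^ k * G0.index i) / 96 * G0.degree j

/-- Off the identity θ is 0 or `fix i`, so θ^(k+1) = `fix i`^k θ there; a multiple of the regular
character corrects the value at 1. The index k of `powMult` belongs to the power k + 1, which avoids
the power 0. -/
lemma sum_powMult_chi (i : Label) (k : ℕ) (g : H1) :
    ∑ j, (powMult i k j : ℂ) * chi j g = θ i g ^ (k + 1) := by
  obtain ⟨x, rfl⟩ := G0.iso.surjective g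
  simp only [powMult]
  push_cast
  simp only [add_mul, Finset.sum_add_distrib, mul_assoc, ← Finset.mul_sum, sum_mult_chi,
    sum_degree_chi]
  by_cases hx : x = 1
  · subst hx
    rw [map_one, G0.θ_one, if_pos rfl]
    ring
  · rw [if_neg hx]
    rcases G0.θ_of_ne_one i hx with h | h <;> rw [h]
    · simp
    · ring

/-- The ranks of the multiplicity spaces are natural numbers; linear independence of the characters
identifies them with the rational closed form. -/
lemma exists_multiplicities_pow (i : Label) (k : ℕ) (Ω : Type*) [Finite Ω] [MulAction H1 Ω]
    (hΩ : permChar H1 Ω = θ i) :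
    ∃ v : Fin 16 → ℕ, (∀ j, (v j : ℚ) = powMult i k j) ∧
      HasMultiplicities chi (permChar H1 Ω ^ (k + 1)) v ∧
      Nonempty (centralizerRing H1 Ω (k + 1) ≃ₐ[ℂ] ∀ j, Matrix (Fin (v j)) (Fin (v j)) ℂ) := by
  classical
  obtain ⟨v, hv, e⟩ := regularIdentity_irrepH1.exists_multiplicities degree_irrepH1_pos
    (tensorPower (Representation.ofMulAction ℂ H1 Ω) (k + 1))
  simp only [character_tensorPower, character_ofMulAction] at hv
  refine ⟨v, fun j => ?_, hv, e⟩
  have := regularIdentity_irrepH1.coeff_unique degree_irrepH1_pos (v := fun j => (v j : ℂ))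
    (w := fun j => (powMult i k j : ℂ)) fun g => by
      rw [← hv, hΩ]
      exact (sum_powMult_chi i k g).symm
  exact_mod_cast congrFun this j

/-! ### Grouping matrix blocks of equal size. -/

section Blocks

/-- The product of the matrix algebras of given sizes. -/
abbrev Blocks {κ : Type} (w : κ → ℕ) : Type := ∀ k, Matrix (Fin (w k)) (Fin (w k)) ℂ

/-- Constant sizes. -/
lemma blocks_const {n r : ℕ} {w : Fin n → ℕ} (h : ∀ k, w k = r) :
    Nonempty (Blocks w ≃ₐ[ℂ] nM n r) := by
  obtain rfl : w = fun _ => r := funext h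
  exact ⟨AlgEquiv.refl⟩

/-- Sizes indexed by a disjoint union. -/
lemma blocks_sum {κ κ' : Type} {w : κ ⊕ κ' → ℕ} {B B' : Type} [Semiring B] [Algebra ℂ B]
    [Semiring B'] [Algebra ℂ B']
    (h : Nonempty (Blocks (fun k => w (Sum.inl k)) ≃ₐ[ℂ] B))
    (h' : Nonempty (Blocks (fun k => w (Sum.inr k)) ≃ₐ[ℂ] B')) :
    Nonempty (Blocks w ≃ₐ[ℂ] B × B') := by
  obtain ⟨e⟩ := h
  obtain ⟨e'⟩ := h'
  let s : Blocks w ≃ₐ[ℂ] Blocks (fun k => w (Sum.inl k)) × Blocks (fun k => w (Sum.inr k)) :=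
    { Equiv.sumPiEquivProdPi (fun k => Matrix (Fin (w k)) (Fin (w k)) ℂ) with
      map_mul' := fun _ _ => rfl
      map_add' := fun _ _ => rfl
      commutes' := fun _ => rfl }
  exact ⟨s.trans (AlgEquiv.prodCongr e e')⟩

/-- Reindexing of sizes. -/
lemma blocks_reindex {κ κ' : Type} (f : κ → κ') (hf : Function.Bijective f) {w : κ' → ℕ}
    {B : Type} [Semiring B] [Algebra ℂ B] (h : Nonempty (Blocks (fun k => w (f k)) ≃ₐ[ℂ] B)) :
    Nonempty (Blocks w ≃ₐ[ℂ] B) := by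
  obtain ⟨e⟩ := h
  exact ⟨(AlgEquiv.piCongrLeft ℂ (fun k => Matrix (Fin (w k)) (Fin (w k)) ℂ)
    (Equiv.ofBijective f hf)).symm.trans e⟩

end Blocks

/-- `powMult i k j` depends on j only through `mult` and `degree`, so coincidences valid for all k
are read off the tables. -/
lemma eq_of_powMult {i : Label} {k : ℕ} {v : Fin 16 → ℕ} (hv : ∀ j, (v j : ℚ) = powMult i k j)
    {n : ℕ} (f : Fin n → Fin 16) (r : Fin 16)
    (h : ∀ a, G0.mult i (f a) = G0.mult i r ∧ G0.degree (f a) = G0.degree r) (a : Fin n) :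
    v (f a) = v r := by
  have : (v (f a) : ℚ) = v r := by rw [hv, hv, powMult, powMult, (h a).1, (h a).2]
  exact_mod_cast this

lemma eq_comp_of_powMult {i : Label} {k : ℕ} {v : Fin 16 → ℕ}
    (hv : ∀ j, (v j : ℚ) = powMult i k j) (f : Fin 16 → Fin 16)
    (h : ∀ a, G0.mult i (f a) = G0.mult i a ∧ G0.degree (f a) = G0.degree a) :
    (fun a => v (f a)) = v :=
  funext fun a => eq_of_powMult hv (fun _ : Fin 1 => f a) a (fun _ => h a) 0

/-- The exponent k - 2 equals -1 at k = 1, hence the integer power. -/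
lemma four_zpow (m : ℕ) : (4 : ℚ) ^ (((m + 1 : ℕ) : ℤ) - 2) = 4 ^ m / 4 := by
  rw [show ((m + 1 : ℕ) : ℤ) - 2 = m - 1 by push_cast; ring, zpow_sub_one₀ (by norm_num),
    zpow_natCast, div_eq_mul_inv]

lemma hasMultiplicities_of_eq {G : Type*} [Group G] {χ : Fin 16 → G → ℂ} {f : G → ℂ}
    {v w : Fin 16 → ℕ} (h : HasMultiplicities χ f v) (hvw : v = w) : HasMultiplicities χ f w :=
  hvw ▸ h

end CentralizerH1

end

open CentralizerH1 in
theorem mainTheorem1 :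
    -- the five coset representations are faithful
    (∀ i : Label, FaithfulSMul H1 (H1 ⧸ stab i)) ∧
    -- a numbering of all the irreducible characters, the first one being the identity character
    ∃ χ : Fin 16 → H1 → ℂ,
      Function.Injective χ ∧
      Set.range χ = {f | IsIrreducibleCharacter f} ∧
      χ 0 = 1 ∧
      ∀ (Ω : Type*) [Finite Ω] [MulAction H1 Ω] [FaithfulSMul H1 Ω]
        [MulAction.IsPretransitive H1 Ω],
        (∃! i : Label, PermEquiv H1 Ω (H1 ⧸ stab i)) ∧
        ∀ k : ℕ, 1 ≤ k →
          (permChar H1 Ω = θ .one →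
            ∃ a e l p : ℕ,
              (a : ℚ) = 96 ^ (k - 1) ∧
              (e : ℚ) = 96 ^ k / 48 ∧
              (l : ℚ) = 96 ^ k / 32 ∧
              (p : ℚ) = 96 ^ k / 24 ∧
              HasMultiplicities χ (permChar H1 Ω ^ k)
                ![a, a, a, a, e, e, e, e, e, e, l, l, l, l, p, p] ∧
              Nonempty (centralizerRing H1 Ω k ≃ₐ[ℂ] nM 4 a × nM 6 e × nM 4 l × nM 2 p)) ∧
          (permChar H1 Ω = θ .three →
            ∃ a c e f g l n p : ℕ,
              (a : ℚ) = 48 ^ (k - 1) / 2 + 8 ^ (k - 1) / 2 ∧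
              (c : ℚ) = 48 ^ (k - 1) / 2 - 8 ^ (k - 1) / 2 ∧
              (e : ℚ) = 48 ^ (k - 1) + 8 ^ (k - 1) ∧
              (f : ℚ) = 48 ^ (k - 1) - 8 ^ (k - 1) ∧
              (g : ℚ) = 48 ^ (k - 1) ∧
              (l : ℚ) = 48 ^ k / 32 - 8 ^ (k - 1) / 2 ∧
              (n : ℚ) = 48 ^ k / 32 + 8 ^ (k - 1) / 2 ∧
              (p : ℚ) = 48 ^ k / 24 ∧
              HasMultiplicities χ (permChar H1 Ω ^ k)
                ![a, a, c, c, e, f, g, g, g, g, l, l, n, n, p, p] ∧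
              Nonempty (centralizerRing H1 Ω k ≃ₐ[ℂ]
                nM 2 a × nM 2 c × nM 1 e × nM 1 f × nM 4 g × nM 2 l × nM 2 n × nM 2 p)) ∧
          (permChar H1 Ω = θ .four →
            ∃ a e l p : ℕ,
              (a : ℚ) = 32 ^ (k - 1) / 3 + 8 ^ k / 12 ∧
              (e : ℚ) = 32 ^ k / 48 - 8 ^ k / 12 ∧
              (l : ℚ) = 32 ^ (k - 1) ∧
              (p : ℚ) = 32 ^ k / 24 + 8 ^ k / 12 ∧
              HasMultiplicities χ (permChar H1 Ω ^ k)
                ![a, a, a, a, e, e, e, e, e, e, l, l, l, l, p, p] ∧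
              Nonempty (centralizerRing H1 Ω k ≃ₐ[ℂ] nM 4 a × nM 6 e × nM 4 l × nM 2 p)) ∧
          (permChar H1 Ω = θ .eight →
            ∃ a b e f l m p : ℕ,
              (a : ℚ) = 24 ^ (k - 1) / 4 + 3 * 4 ^ ((k : ℤ) - 2) ∧
              (b : ℚ) = 24 ^ (k - 1) / 4 - 4 ^ ((k : ℤ) - 2) ∧
              (e : ℚ) = 24 ^ (k - 1) / 2 + 4 ^ (k - 1) / 2 ∧
              (f : ℚ) = 24 ^ (k - 1) / 2 - 4 ^ (k - 1) / 2 ∧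
              (l : ℚ) = 24 ^ k / 32 - 3 * 4 ^ ((k : ℤ) - 2) ∧
              (m : ℚ) = 24 ^ k / 32 + 4 ^ ((k : ℤ) - 2) ∧
              (p : ℚ) = 24 ^ (k - 1) ∧
              HasMultiplicities χ (permChar H1 Ω ^ k)
                ![a, b, b, b, e, f, e, e, f, f, l, m, m, m, p, p] ∧
              Nonempty (centralizerRing H1 Ω k ≃ₐ[ℂ]
                nM 1 a × nM 3 b × nM 1 e × nM 3 f × nM 2 e × nM 1 l × nM 3 m × nM 2 p)) ∧
          (permChar H1 Ω = θ .nine →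
            ∃ a b e f l m p : ℕ,
              (a : ℚ) = 24 ^ (k - 1) / 4 + 3 * 4 ^ ((k : ℤ) - 2) ∧
              (b : ℚ) = 24 ^ (k - 1) / 4 - 4 ^ ((k : ℤ) - 2) ∧
              (e : ℚ) = 24 ^ (k - 1) / 2 + 4 ^ (k - 1) / 2 ∧
              (f : ℚ) = 24 ^ (k - 1) / 2 - 4 ^ (k - 1) / 2 ∧
              (l : ℚ) = 24 ^ k / 32 - 3 * 4 ^ ((k : ℤ) - 2) ∧
              (m : ℚ) = 24 ^ k / 32 + 4 ^ ((k : ℤ) - 2) ∧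
              (p : ℚ) = 24 ^ (k - 1) ∧
              HasMultiplicities χ (permChar H1 Ω ^ k)
                ![a, b, b, b, e, f, f, f, e, e, l, m, m, m, p, p] ∧
              Nonempty (centralizerRing H1 Ω k ≃ₐ[ℂ]
                nM 1 a × nM 3 b × nM 1 e × nM 3 f × nM 2 e × nM 1 l × nM 3 m × nM 2 p)) := by
  have hpos := degree_irrepH1_pos
  refine ⟨faithfulSMul_quotient_stab, chi, ?_, ?_, ?_, ?_⟩
  · classical exact (regularIdentity_irrepH1.linearIndependent hpos).injective
  · classical
    refine Set.Subset.antisymm ?_ fun f hf =>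
      regularIdentity_irrepH1.mem_range_of_isIrreducibleCharacter hpos hf
    rintro _ ⟨j, rfl⟩
    exact regularIdentity_irrepH1.isIrreducibleCharacter hpos j
  · funext g
    obtain ⟨x, rfl⟩ := G0.iso.surjective g
    exact (matChar_irrepH1 0 x).trans (map_one _)
  · intro Ω _ _ _ _
    refine ⟨existsUnique_permEquiv Ω, fun k hk => ?_⟩
    obtain ⟨m, rfl⟩ : ∃ m, k = m + 1 := ⟨k - 1, by omega⟩
    have hz := four_zpow m
    push_cast at hz
    refine ⟨?_, ?_, ?_, ?_, ?_⟩
    · intro hΩ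
      obtain ⟨v, hv, hm, ⟨e⟩⟩ := exists_multiplicities_pow .one m Ω hΩ
      -- One representative index for each class of equal multiplicities.
      refine ⟨v 0, v 4, v 10, v 14,
        ?_, ?_, ?_, ?_, ?_, ?_⟩
      iterate 4
        · rw [hv]
          simp [powMult, G0.mult, G0.degree, G0.index, G0.fix, G0.stabOrder]
          try ring
      · refine hasMultiplicities_of_eq hm ((eq_comp_of_powMult hv
          ![0, 0, 0, 0, 4, 4, 4, 4, 4, 4, 10, 10, 10, 10, 14, 14] (by decide)).symm.trans ?_)
        funext j
        fin_cases j <;> rfl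
      · obtain ⟨e'⟩ := blocks_reindex (w := v)
          (Sum.elim ![0, 1, 2, 3] (Sum.elim ![4, 5, 6, 7, 8, 9] (Sum.elim ![10, 11, 12, 13] ![14, 15])) : Fin 4 ⊕ Fin 6 ⊕ Fin 4 ⊕ Fin 2 → Fin 16)
          (by decide)
          (blocks_sum (blocks_const (eq_of_powMult hv ![0, 1, 2, 3] 0 (by decide)))
          (blocks_sum (blocks_const (eq_of_powMult hv ![4, 5, 6, 7, 8, 9] 4 (by decide)))
          (blocks_sum (blocks_const (eq_of_powMult hv ![10, 11, 12, 13] 10 (by decide)))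
          (blocks_const (eq_of_powMult hv ![14, 15] 14 (by decide))))))
        exact ⟨e.trans e'⟩
    · intro hΩ
      obtain ⟨v, hv, hm, ⟨e⟩⟩ := exists_multiplicities_pow .three m Ω hΩ
      refine ⟨v 0, v 2, v 4, v 5, v 6, v 10, v 12, v 14,
        ?_, ?_, ?_, ?_, ?_, ?_, ?_, ?_, ?_, ?_⟩
      iterate 8
        · rw [hv]
          simp [powMult, G0.mult, G0.degree, G0.index, G0.fix, G0.stabOrder]
          try ring
      · refine hasMultiplicities_of_eq hm ((eq_comp_of_powMult hv
          ![0, 0, 2, 2, 4, 5, 6, 6, 6, 6, 10, 10, 12, 12, 14, 14] (by decide)).symm.trans ?_)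
        funext j
        fin_cases j <;> rfl
      · obtain ⟨e'⟩ := blocks_reindex (w := v)
          (Sum.elim ![0, 1] (Sum.elim ![2, 3] (Sum.elim ![4] (Sum.elim ![5] (Sum.elim ![6, 7, 8, 9] (Sum.elim ![10, 11] (Sum.elim ![12, 13] ![14, 15])))))) : Fin 2 ⊕ Fin 2 ⊕ Fin 1 ⊕ Fin 1 ⊕ Fin 4 ⊕ Fin 2 ⊕ Fin 2 ⊕ Fin 2 → Fin 16)
          (by decide)
          (blocks_sum (blocks_const (eq_of_powMult hv ![0, 1] 0 (by decide)))
          (blocks_sum (blocks_const (eq_of_powMult hv ![2, 3] 2 (by decide)))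
          (blocks_sum (blocks_const (eq_of_powMult hv ![4] 4 (by decide)))
          (blocks_sum (blocks_const (eq_of_powMult hv ![5] 5 (by decide)))
          (blocks_sum (blocks_const (eq_of_powMult hv ![6, 7, 8, 9] 6 (by decide)))
          (blocks_sum (blocks_const (eq_of_powMult hv ![10, 11] 10 (by decide)))
          (blocks_sum (blocks_const (eq_of_powMult hv ![12, 13] 12 (by decide)))
          (blocks_const (eq_of_powMult hv ![14, 15] 14 (by decide))))))))))
        exact ⟨e.trans e'⟩
    · intro hΩ
      obtain ⟨v, hv, hm, ⟨e⟩⟩ := exists_multiplicities_pow .four m Ω hΩ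
      refine ⟨v 0, v 4, v 10, v 14,
        ?_, ?_, ?_, ?_, ?_, ?_⟩
      iterate 4
        · rw [hv]
          simp [powMult, G0.mult, G0.degree, G0.index, G0.fix, G0.stabOrder]
          try ring
      · refine hasMultiplicities_of_eq hm ((eq_comp_of_powMult hv
          ![0, 0, 0, 0, 4, 4, 4, 4, 4, 4, 10, 10, 10, 10, 14, 14] (by decide)).symm.trans ?_)
        funext j
        fin_cases j <;> rfl
      · obtain ⟨e'⟩ := blocks_reindex (w := v)
          (Sum.elim ![0, 1, 2, 3] (Sum.elim ![4, 5, 6, 7, 8, 9] (Sum.elim ![10, 11, 12, 13] ![14, 15])) : Fin 4 ⊕ Fin 6 ⊕ Fin 4 ⊕ Fin 2 → Fin 16)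
          (by decide)
          (blocks_sum (blocks_const (eq_of_powMult hv ![0, 1, 2, 3] 0 (by decide)))
          (blocks_sum (blocks_const (eq_of_powMult hv ![4, 5, 6, 7, 8, 9] 4 (by decide)))
          (blocks_sum (blocks_const (eq_of_powMult hv ![10, 11, 12, 13] 10 (by decide)))
          (blocks_const (eq_of_powMult hv ![14, 15] 14 (by decide))))))
        exact ⟨e.trans e'⟩
    · intro hΩ
      obtain ⟨v, hv, hm, ⟨e⟩⟩ := exists_multiplicities_pow .eight m Ω hΩ
      refine ⟨v 0, v 1, v 4, v 5, v 10, v 11, v 14,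
        ?_, ?_, ?_, ?_, ?_, ?_, ?_, ?_, ?_⟩
      iterate 7
        · rw [hv]
          simp [powMult, G0.mult, G0.degree, G0.index, G0.fix, G0.stabOrder, hz]
          try ring
      · refine hasMultiplicities_of_eq hm ((eq_comp_of_powMult hv
          ![0, 1, 1, 1, 4, 5, 4, 4, 5, 5, 10, 11, 11, 11, 14, 14] (by decide)).symm.trans ?_)
        funext j
        fin_cases j <;> rfl
      · obtain ⟨e'⟩ := blocks_reindex (w := v)
          (Sum.elim ![0] (Sum.elim ![1, 2, 3] (Sum.elim ![4] (Sum.elim ![5, 8, 9] (Sum.elim ![6, 7] (Sum.elim ![10] (Sum.elim ![11, 12, 13] ![14, 15])))))) : Fin 1 ⊕ Fin 3 ⊕ Fin 1 ⊕ Fin 3 ⊕ Fin 2 ⊕ Fin 1 ⊕ Fin 3 ⊕ Fin 2 → Fin 16)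
          (by decide)
          (blocks_sum (blocks_const (eq_of_powMult hv ![0] 0 (by decide)))
          (blocks_sum (blocks_const (eq_of_powMult hv ![1, 2, 3] 1 (by decide)))
          (blocks_sum (blocks_const (eq_of_powMult hv ![4] 4 (by decide)))
          (blocks_sum (blocks_const (eq_of_powMult hv ![5, 8, 9] 5 (by decide)))
          -- These blocks have the size of the one at index 4, although they form a separate
          -- summand.
          (blocks_sum (blocks_const (eq_of_powMult hv ![6, 7] 4 (by decide)))
          (blocks_sum (blocks_const (eq_of_powMult hv ![10] 10 (by decide)))
          (blocks_sum (blocks_const (eq_of_powMult hv ![11, 12, 13] 11 (by decide)))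
          (blocks_const (eq_of_powMult hv ![14, 15] 14 (by decide))))))))))
        exact ⟨e.trans e'⟩
    · intro hΩ
      obtain ⟨v, hv, hm, ⟨e⟩⟩ := exists_multiplicities_pow .nine m Ω hΩ
      refine ⟨v 0, v 1, v 4, v 5, v 10, v 11, v 14,
        ?_, ?_, ?_, ?_, ?_, ?_, ?_, ?_, ?_⟩
      iterate 7
        · rw [hv]
          simp [powMult, G0.mult, G0.degree, G0.index, G0.fix, G0.stabOrder, hz]
          try ring
      · refine hasMultiplicities_of_eq hm ((eq_comp_of_powMult hv
          ![0, 1, 1, 1, 4, 5, 5, 5, 4, 4, 10, 11, 11, 11, 14, 14] (by decide)).symm.trans ?_)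
        funext j
        fin_cases j <;> rfl
      · obtain ⟨e'⟩ := blocks_reindex (w := v)
          (Sum.elim ![0] (Sum.elim ![1, 2, 3] (Sum.elim ![4] (Sum.elim ![5, 6, 7] (Sum.elim ![8, 9] (Sum.elim ![10] (Sum.elim ![11, 12, 13] ![14, 15])))))) : Fin 1 ⊕ Fin 3 ⊕ Fin 1 ⊕ Fin 3 ⊕ Fin 2 ⊕ Fin 1 ⊕ Fin 3 ⊕ Fin 2 → Fin 16)
          (by decide)
          (blocks_sum (blocks_const (eq_of_powMult hv ![0] 0 (by decide)))
          (blocks_sum (blocks_const (eq_of_powMult hv ![1, 2, 3] 1 (by decide)))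
          (blocks_sum (blocks_const (eq_of_powMult hv ![4] 4 (by decide)))
          (blocks_sum (blocks_const (eq_of_powMult hv ![5, 6, 7] 5 (by decide)))
          (blocks_sum (blocks_const (eq_of_powMult hv ![8, 9] 4 (by decide)))
          (blocks_sum (blocks_const (eq_of_powMult hv ![10] 10 (by decide)))
          (blocks_sum (blocks_const (eq_of_powMult hv ![11, 12, 13] 11 (by decide)))
          (blocks_const (eq_of_powMult hv ![14, 15] 14 (by decide))))))))))
        exact ⟨e.trans e'⟩
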